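/- Let $M$ be an oriented smooth three-dimensional manifold with a smooth Riemannian metric $g$, and let $v$ be a smooth nowhere vanishing vector field on $M$. For a vector field $J$ on an open set let $\mathcal J$ be the bivector field $\mathcal J(a,b)=\mathrm{vol}(J,a^\sharp,b^\sharp)$, so that $\mathcal J(dH)=J\times\nabla H$; $J$ is called a Poisson vector field if $\mathcal J$ is a Poisson structure, i.e. if the bracket $\{f,h\}=\mathcal J(df,dh)$ satisfies the Jacobi identity. Two Poisson structures are called compatible if they are nowhere multiples of each other and their sum is a Poisson structure. Around every point of $M$ there is a smooth positively oriented orthonormal frame $(\hat e_1,\hat e_2,\hat e_3)$ with $\hat e_1=v/\|v\|$. Let $(\hat e_1,\hat e_2,\hat e_3)$ be any such frame on an open set $U$, with structure functions $C_{ij}^k$ defined by $[\hat e_i,\hat e_j]=\sum_k C_{ij}^k\hat e_k$, and consider, for $i=1,2$, the equations $$\hat e_1\cdot\nabla\mu_i=-C_{31}^2-\mu_i\,(C_{31}^3+C_{12}^2)-\mu_i^2\,C_{12}^3,\qquad \hat e_1\cdot\nabla\ln\frac{|\alpha_i|}{\|v\|}=C_{31}^3+\mu_i\,C_{12}^3\qquad(*)$$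 for smooth functions $\mu_i$, $\alpha_i$ with $\mu_1\ne\mu_2$ everywhere and $\alpha_i$ nowhere zero. 1. If $\mu_1,\mu_2,\alpha_1,\alpha_2$ solve $(*)$ on an open set $V\subseteq U$, then $J_i=\alpha_i(\hat e_2+\mu_i\hat e_3)$, $i=1,2$, define a compatible pair of Poisson structures on $V$, and $v$ is locally bi-Hamiltonian for them: every point of $V$ has a neighbourhood on which there are smooth functions $H_1,H_2$ with $v=J_1\times\nabla H_2=J_2\times\nabla H_1$. 2. Every point of $U$ has an open neighbourhood $V\subseteq U$ on which $(*)$ has solutions $\mu_1,\mu_2,\alpha_1,\alpha_2$ for which there are smooth functions $H_1,H_2$ on $V$ such that the vector fields $J_i=\alpha_i(\hat e_2+\mu_i\hat e_3)$ (a compatible pair of Poisson structures, by 1) satisfy $$v=J_1\times\nabla H_2=J_2\times\nabla H_1,\qquad J_i=(-1)^{i}\,\phi\,\nabla H_i\quad(i=1,2),\qquad \phi=\frac{\alpha_1\alpha_2(\mu_2-\mu_1)}{\|v\|}.$$ -/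

import Mathlib

open scoped Manifold ContDiff Bundle

noncomputable section

namespace BiHamiltonian

section Fiber

variable {M : Type*} [TopologicalSpace M] [ChartedSpace (EuclideanSpace ℝ (Fin 3)) M]

instance tangentSpace_finiteDimensional (x : M) :
    FiniteDimensional ℝ (TangentSpace (𝓡 3) x) :=
  inferInstanceAs (FiniteDimensional ℝ (EuclideanSpace ℝ (Fin 3)))

instance tangentSpace_finrank (x : M) :
    Fact (Module.finrank ℝ (TangentSpace (𝓡 3) x) = 3) :=
  ⟨finrank_euclideanSpace_fin (𝕜 := ℝ) (n := 3)⟩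

end Fiber

/-- Smoothness of a vector field on a set of points. -/
def SmoothFieldOn {M : Type*} [TopologicalSpace M] [ChartedSpace (EuclideanSpace ℝ (Fin 3)) M]
    [IsManifold (𝓡 3) ∞ M] (X : ∀ x : M, TangentSpace (𝓡 3) x) (U : Set M) : Prop :=
  ContMDiffOn (𝓡 3) (𝓡 3).tangent ∞ (fun x => (⟨x, X x⟩ : TangentBundle (𝓡 3) M)) U

/-- Smoothness of a real-valued function on a set of points. -/
def SmoothOn {M : Type*} [TopologicalSpace M] [ChartedSpace (EuclideanSpace ℝ (Fin 3)) M]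
    (f : M → ℝ) (U : Set M) : Prop :=
  ContMDiffOn (𝓡 3) 𝓘(ℝ, ℝ) ∞ f U

section Poisson

variable {M : Type*} [TopologicalSpace M] [ChartedSpace (EuclideanSpace ℝ (Fin 3)) M]

/-- The cotangent space. -/
abbrev Cotangent (x : M) : Type := TangentSpace (𝓡 3) x →L[ℝ] ℝ

/-- The differential of a real-valued function. -/
def diff (f : M → ℝ) (x : M) : Cotangent x := mvfderiv (𝓡 3) f x

/-- The derivative `X · ∇ f` of a function along a vector field. -/
def along (X : ∀ x : M, TangentSpace (𝓡 3) x) (f : M → ℝ) (x : M) : ℝ := diff f x (X x)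

variable (M) in
/-- Bivector fields: at each point an element of `Λ² T_x M`, seen as an alternating bilinear form
on the cotangent space. -/
abbrev BivectorField : Type _ := ∀ x : M, (Cotangent x) [⋀^Fin 2]→ₗ[ℝ] ℝ

/-- The bracket `{f, g} = 𝒥(df, dg)` of functions defined by a bivector field. -/
def bracket (𝒥 : BivectorField M) (f g : M → ℝ) (x : M) : ℝ := 𝒥 x ![diff f x, diff g x]

/-- A bivector field is a Poisson structure on the open set `U` if it is smooth on `U` and its
bracket satisfies the Jacobi identity there (equivalently its Schouten-Nijenhuis bracket with
itself vanishes on `U`). Both are tested on functions defined on open subsets of `U`. -/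
structure IsPoissonOn (𝒥 : BivectorField M) (U : Set M) : Prop where
  smooth : ∀ V ⊆ U, IsOpen V → ∀ f g : M → ℝ, SmoothOn f V → SmoothOn g V →
    SmoothOn (bracket 𝒥 f g) V
  jacobi : ∀ V ⊆ U, IsOpen V → ∀ f g h : M → ℝ, SmoothOn f V → SmoothOn g V → SmoothOn h V →
    ∀ x ∈ V, bracket 𝒥 f (bracket 𝒥 g h) x + bracket 𝒥 g (bracket 𝒥 h f) x +
      bracket 𝒥 h (bracket 𝒥 f g) x = 0

/-- Two bivector fields are compatible Poisson structures on `U`: they are Poisson structures,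
nowhere multiples of each other, and their sum is a Poisson structure. -/
structure IsCompatiblePairOn (𝒥₁ 𝒥₂ : BivectorField M) (U : Set M) : Prop where
  poisson₁ : IsPoissonOn 𝒥₁ U
  poisson₂ : IsPoissonOn 𝒥₂ U
  independent : ∀ x ∈ U, LinearIndependent ℝ ![𝒥₁ x, 𝒥₂ x]
  poisson_add : IsPoissonOn (fun x => 𝒥₁ x + 𝒥₂ x) U

/-- `v = 𝒥(dH)` on `U`, where `𝒥(a)` is the tangent vector with `b (𝒥(a)) = 𝒥(a, b)` for all
covectors `b`. -/
def IsHamiltonianOn (v : ∀ x : M, TangentSpace (𝓡 3) x) (𝒥 : BivectorField M) (H : M → ℝ)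
    (U : Set M) : Prop :=
  SmoothOn H U ∧ ∀ x ∈ U, ∀ b : Cotangent x, b (v x) = 𝒥 x ![diff H x, b]

/-- `v = 𝒥₁(dH₂) = 𝒥₂(dH₁)` on `U`, with Poisson structures `𝒥₁`, `𝒥₂` that are nowhere multiples
of each other. -/
structure IsBiHamiltonianOn (v : ∀ x : M, TangentSpace (𝓡 3) x) (𝒥₁ 𝒥₂ : BivectorField M)
    (H₁ H₂ : M → ℝ) (U : Set M) : Prop where
  poisson₁ : IsPoissonOn 𝒥₁ U
  poisson₂ : IsPoissonOn 𝒥₂ U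
  independent : ∀ x ∈ U, LinearIndependent ℝ ![𝒥₁ x, 𝒥₂ x]
  hamiltonian₁ : IsHamiltonianOn v 𝒥₁ H₂ U
  hamiltonian₂ : IsHamiltonianOn v 𝒥₂ H₁ U

end Poisson

section Riemannian

variable {M : Type*} [TopologicalSpace M] [ChartedSpace (EuclideanSpace ℝ (Fin 3)) M]
  [Bundle.RiemannianBundle (fun x : M => TangentSpace (𝓡 3) x)]

/-- The tangent vector metrically dual to a covector. -/
def sharp (x : M) : Cotangent x →ₗ[ℝ] TangentSpace (𝓡 3) x where
  toFun a := (InnerProductSpace.toDual ℝ (TangentSpace (𝓡 3) x)).symm a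
  map_add' a b := map_add _ a b
  map_smul' c a := by simp

/-- The gradient of a function for the Riemannian metric. -/
def grad (f : M → ℝ) (x : M) : TangentSpace (𝓡 3) x := sharp x (diff f x)

/-- The bivector field associated with a vector field `J` by metric and orientation:
`𝒥(a, b) = vol(J, a♯, b♯)`. Thus `𝒥(dH) = J × ∇H`. -/
def toBivector (o : ∀ x : M, Orientation ℝ (TangentSpace (𝓡 3) x) (Fin 3))
    (J : ∀ x : M, TangentSpace (𝓡 3) x) : BivectorField M := fun x =>
  ((o x).volumeForm.curryLeft (J x)).compLinearMap (sharp x)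

/-- A pointwise choice of orientations of the tangent spaces is an orientation of `M` if around
each point there is a smooth frame that is positively oriented at all points. -/
def IsOrientation [IsManifold (𝓡 3) ∞ M]
    (o : ∀ x : M, Orientation ℝ (TangentSpace (𝓡 3) x) (Fin 3)) : Prop :=
  ∀ p : M, ∃ U : Set M, IsOpen U ∧ p ∈ U ∧ ∃ e : Fin 3 → ∀ x : M, TangentSpace (𝓡 3) x,
    (∀ i, SmoothFieldOn (e i) U) ∧ ∀ x ∈ U, 0 < (o x).volumeForm (fun i => e i x)

/-- `(e 0, e 1, e 2)` is a smooth positively oriented orthonormal frame on `U` whose first vector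
is `v / ‖v‖`. -/
structure IsAdaptedFrameOn [IsManifold (𝓡 3) ∞ M]
    (o : ∀ x : M, Orientation ℝ (TangentSpace (𝓡 3) x) (Fin 3))
    (v : ∀ x : M, TangentSpace (𝓡 3) x) (e : Fin 3 → ∀ x : M, TangentSpace (𝓡 3) x)
    (U : Set M) : Prop where
  smooth : ∀ i, SmoothFieldOn (e i) U
  orthonormal : ∀ x ∈ U, Orthonormal ℝ (fun i => e i x)
  first : ∀ x ∈ U, e 0 x = ‖v x‖⁻¹ • v x
  positive : ∀ x ∈ U, 0 < (o x).volumeForm (fun i => e i x)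

/-- The structure functions of an orthonormal frame: `[e i, e j] = ∑ k, C i j k • e k`.
All indices are shifted by one, they run through `0, 1, 2`. -/
def structFun (e : Fin 3 → ∀ x : M, TangentSpace (𝓡 3) x) (i j k : Fin 3) (x : M) : ℝ :=
  inner ℝ (VectorField.mlieBracket (𝓡 3) (e i) (e j) x) (e k x)

/-- The Riccati equation
`e₁ · ∇μ = - C₃₁² - μ (C₃₁³ + C₁₂²) - μ² C₁₂³` on `U`. -/
def RiccatiOn (e : Fin 3 → ∀ x : M, TangentSpace (𝓡 3) x) (μ : M → ℝ) (U : Set M) : Prop :=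
  ∀ x ∈ U, along (e 0) μ x = - structFun e 2 0 1 x
    - μ x * (structFun e 2 0 2 x + structFun e 0 1 1 x) - μ x ^ 2 * structFun e 0 1 2 x

/-- The transport equation `e₁ · ∇ ln (α / ‖v‖) = C₃₁³ + μ C₁₂³` on `U`, for nonvanishing `α`.
Here `Real.log t` is `ln |t|`. -/
def TransportOn (v : ∀ x : M, TangentSpace (𝓡 3) x)
    (e : Fin 3 → ∀ x : M, TangentSpace (𝓡 3) x) (μ α : M → ℝ) (U : Set M) : Prop :=
  ∀ x ∈ U, along (e 0) (fun y => Real.log (α y / ‖v y‖)) x =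
    structFun e 2 0 2 x + μ x * structFun e 0 1 2 x

/-- The Poisson vector field `J = α (e₂ + μ e₃)`. -/
def poissonVector (e : Fin 3 → ∀ x : M, TangentSpace (𝓡 3) x) (μ α : M → ℝ) (x : M) :
    TangentSpace (𝓡 3) x :=
  α x • (e 1 x + μ x • e 2 x)

/-- Smooth solutions on `U` of the Riccati and transport equations: `μ₁`, `μ₂` are nowhere equal,
`α₁`, `α₂` vanish nowhere. -/
structure IsSolutionOn (v : ∀ x : M, TangentSpace (𝓡 3) x)
    (e : Fin 3 → ∀ x : M, TangentSpace (𝓡 3) x) (μ₁ μ₂ α₁ α₂ : M → ℝ) (U : Set M) : Prop where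
  smooth_μ₁ : SmoothOn μ₁ U
  smooth_μ₂ : SmoothOn μ₂ U
  smooth_α₁ : SmoothOn α₁ U
  smooth_α₂ : SmoothOn α₂ U
  μ_ne : ∀ x ∈ U, μ₁ x ≠ μ₂ x
  α₁_ne : ∀ x ∈ U, α₁ x ≠ 0
  α₂_ne : ∀ x ∈ U, α₂ x ≠ 0
  riccati₁ : RiccatiOn e μ₁ U
  riccati₂ : RiccatiOn e μ₂ U
  transport₁ : TransportOn v e μ₁ α₁ U
  transport₂ : TransportOn v e μ₂ α₂ U

/-- The function `φ = α₁ α₂ (μ₂ - μ₁) / ‖v‖`. -/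
def phi (v : ∀ x : M, TangentSpace (𝓡 3) x) (μ₁ μ₂ α₁ α₂ : M → ℝ) (x : M) : ℝ :=
  α₁ x * α₂ x * (μ₂ x - μ₁ x) / ‖v x‖

end Riemannian

end BiHamiltonian

end

/-!
Let `X = p e₃ - q e₂`, in an adapted frame `(e₁, e₂, e₃)`, whose members are `e 0`, `e 1`, `e 2`
in formulas. The bivector field of `J = p e₂ + q e₃` is `X ∧ e₁`, and it is a Poisson structure as
soon as `[e₁, X]` is a combination of `X` and `e₁` (`isPoissonOn_of_commutator`). Asking for
`[e₁, X] = r X` modulo `e₁`, with a given function `r`, is a pair of equations *linear* in `(p, q)`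
(`IsTransportedOn`). For `J = α (e₂ + μ e₃)` the Riccati equation fixes the direction of `[e₁, X]`
and the transport equation fixes its rate to be `r = e₁ · ∇ ln ‖v‖`, the same for all solutions.
Hence sums of solutions are Poisson as well, which is compatibility
(`IsAdaptedFrameOn.isCompatiblePairOn`).

A function `H` satisfies `v = J × ∇H` iff `H` is constant along `e₁` and `X · ∇H = ‖v‖`. After
division by `‖v‖` the rate `r` is zero: the class of `X / ‖v‖` modulo `e₁` is invariant along
`e₁`. It is therefore a nonvanishing vector field on the local quotient by the flow of `e₁`, and
`H` is a time function for it (`exists_function_deriv_zero_one`,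
`IsTransportedOn.exists_function`).

Conversely let `H₁, H₂` be first integrals of `v` with independent gradients, whose existence is
the flow box theorem. Their gradients are tangent to the planes orthogonal to `e₁`, the slopes
`e₃H / e₂H` solve the Riccati equation because the commutators determine how `e₂H` and
`e₃H` evolve along `e₁`, and the Jacobian `D = e₂H₁ e₃H₂ - e₃H₁ e₂H₂` obeys Liouville's formula,
so that `J = ∓ φ ∇H` with `φ = -‖v‖ / D` solves the transport equation
(`IsAdaptedFrameOn.exists_solution`).

The flow box theorem for smooth fields (`exists_flowBox`, `exists_flowBox_manifold`) rests on
smooth dependence of integral curves on time and initial point (`exists_smooth_flow`), obtained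
from the inverse function theorem in the Banach space of continuous curves. That Lie brackets act
as commutators of derivations is `along_mlieBracket`.
-/

noncomputable section

namespace BiHamiltonian

/-! ### Superposition operators on spaces of continuous maps -/

universe u

section Postcomposition

variable {K E G : Type*} [TopologicalSpace K] [TopologicalSpace E] [TopologicalSpace G]

/-- The superposition operator `γ ↦ F ∘ γ` on spaces of continuous maps. -/
def superpose (F : E → G) (hF : Continuous F) (γ : C(K, E)) : C(K, G) :=
  ⟨F ∘ γ, hF.comp γ.continuous⟩

lemma continuous_superpose (F : E → G) (hF : Continuous F) :
    Continuous (superpose (K := K) F hF) :=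
  ContinuousMap.continuous_postcomp (⟨F, hF⟩ : C(E, G))

end Postcomposition

section Superposition

variable {K : Type*} {E G : Type u} [TopologicalSpace K] [CompactSpace K]
  [NormedAddCommGroup E] [NormedSpace ℝ E] [NormedAddCommGroup G] [NormedSpace ℝ G]

-- Both instances are found by the default instance search as well, but only at great cost.
local instance familyNormedAddCommGroup : NormedAddCommGroup C(K, E →L[ℝ] G) :=
  ContinuousMap.instNormedAddCommGroup

local instance familyNormedSpace : NormedSpace ℝ C(K, E →L[ℝ] G) :=
  ContinuousMap.normedSpace

/-- A continuous family of continuous linear maps acts pointwise on continuous maps. -/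
def pointwiseCLM : C(K, E →L[ℝ] G) →L[ℝ] C(K, E) →L[ℝ] C(K, G) :=
  LinearMap.mkContinuous₂
    (LinearMap.mk₂ ℝ (fun (A : C(K, E →L[ℝ] G)) (γ : C(K, E)) =>
      (⟨fun s => A s (γ s), by fun_prop⟩ : C(K, G)))
      (by intros; ext; simp) (by intros; ext; simp) (by intros; ext; simp) (by intros; ext; simp)) 1
    (by
      intro A γ
      rw [one_mul, ContinuousMap.norm_le _ (by positivity)]
      intro s
      exact ((A s).le_opNorm _).trans
        (mul_le_mul (A.norm_coe_le_norm s) (γ.norm_coe_le_norm s) (norm_nonneg _)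
          (norm_nonneg A)))

@[simp] lemma pointwiseCLM_apply (A : C(K, E →L[ℝ] G)) (γ : C(K, E)) (s : K) :
    pointwiseCLM A γ s = A s (γ s) := rfl

/-- The derivative of the superposition operator of `F` at `γ` is multiplication by `DF ∘ γ`; the
remainder is bounded by the mean value inequality, uniformly because `γ ↦ DF ∘ γ` is continuous. -/
lemma hasFDerivAt_superpose (F : E → G) (hF : ContDiff ℝ 1 F) (γ : C(K, E)) :
    HasFDerivAt (superpose (K := K) F hF.continuous)
      (pointwiseCLM (superpose (fderiv ℝ F) (hF.continuous_fderiv one_ne_zero) γ)) γ := by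
  rw [hasFDerivAt_iff_isLittleO_nhds_zero, Asymptotics.isLittleO_iff]
  intro c hc
  have hcont := (continuous_superpose (K := K) (fderiv ℝ F)
    (hF.continuous_fderiv one_ne_zero)).continuousAt (x := γ)
  rw [Metric.continuousAt_iff] at hcont
  obtain ⟨δ, hδ, h⟩ := hcont c hc
  filter_upwards [Metric.ball_mem_nhds (0 : C(K, E)) hδ] with η hη
  rw [ContinuousMap.norm_le _ (by positivity)]
  intro s
  have hseg : ∀ z ∈ Metric.closedBall (γ s) ‖η s‖, ‖fderiv ℝ F z - fderiv ℝ F (γ s)‖ ≤ c := by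
    intro z hz
    let ζ : C(K, E) := γ + ContinuousMap.const K (z - γ s)
    have hζ : dist ζ γ < δ := by
      rw [dist_eq_norm]
      have : ‖ζ - γ‖ ≤ ‖η‖ := by
        rw [ContinuousMap.norm_le _ (by positivity)]
        intro t
        simp only [ζ, add_sub_cancel_left, ContinuousMap.const_apply]
        exact (mem_closedBall_iff_norm.1 hz).trans (η.norm_coe_le_norm s)
      exact this.trans_lt (mem_ball_zero_iff.1 hη)
    have h2 := (ContinuousMap.dist_lt_iff hc).1 (h hζ) s
    rw [dist_eq_norm] at h2
    simpa [superpose, ζ] using h2.le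
  have hmv := (convex_closedBall (γ s) ‖η s‖).norm_image_sub_le_of_norm_hasFDerivWithin_le'
    (f := F) (f' := fderiv ℝ F) (φ := fderiv ℝ F (γ s)) (C := c) (x := γ s) (y := γ s + η s)
    (fun z _ => ((hF.differentiable one_ne_zero) z).hasFDerivAt.hasFDerivWithinAt)
    hseg (by simp) (by simp)
  have : ‖η s‖ ≤ ‖η‖ := η.norm_coe_le_norm s
  simp only [add_sub_cancel_left] at hmv
  refine le_trans (le_of_eq ?_) (hmv.trans (mul_le_mul_of_nonneg_left this hc.le))
  simp [superpose]

/-- Smoothness by induction: the derivative is the superposition operator of `DF` followed by a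
continuous linear map. The spaces share a universe since `G` is replaced by `E →L[ℝ] G`. -/
lemma contDiff_nat_superpose (n : ℕ) {G : Type u} [NormedAddCommGroup G] [NormedSpace ℝ G]
    (F : E → G) (hF : ContDiff ℝ n F) :
    ContDiff ℝ n (superpose (K := K) F hF.continuous) := by
  induction n generalizing G with
  | zero => exact contDiff_zero.2 (continuous_superpose F hF.continuous)
  | succ n ih =>
    have h1 : ContDiff ℝ 1 F := hF.of_le (by norm_cast; omega)
    refine (contDiff_succ_iff_hasFDerivAt (n := n)).2
      ⟨_, ?_, fun γ => hasFDerivAt_superpose F h1 γ⟩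
    exact pointwiseCLM.contDiff.comp (ih (fderiv ℝ F) (hF.fderiv_right le_rfl))

lemma contDiff_superpose (F : E → G) (hF : ContDiff ℝ ∞ F) :
    ContDiff ℝ ∞ (superpose (K := K) F hF.continuous) :=
  contDiff_infty.2 fun n => contDiff_nat_superpose n F (hF.of_le (by exact_mod_cast le_top))

end Superposition

/-! ### Smooth local flows and flow boxes in vector spaces -/

section Flow

variable {E : Type*} [NormedAddCommGroup E] [NormedSpace ℝ E]

/-- Inverse function theorem on an open set: the derivative stays invertible near a point where it
is, so the local inverse is smooth on its whole domain, not merely at one point. -/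
theorem exists_openPartialHomeomorph_of_hasFDerivAt_equiv [CompleteSpace E]
    {G : Type*} [NormedAddCommGroup G] [NormedSpace ℝ G]
    {f : E → G} {U : Set E} (hU : IsOpen U) (hf : ContDiffOn ℝ ∞ f U) {p : E} (hp : p ∈ U)
    (f' : E ≃L[ℝ] G) (hf' : HasFDerivAt f (f' : E →L[ℝ] G) p) :
    ∃ e : OpenPartialHomeomorph E G, p ∈ e.source ∧ e.source ⊆ U ∧ (∀ x, e x = f x) ∧
      ContDiffOn ℝ ∞ e.symm e.target := by
  have hfp : ContDiffAt ℝ ∞ f p := hf.contDiffAt (hU.mem_nhds hp)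
  let e₀ := hfp.toOpenPartialHomeomorph f hf' (by simp)
  let W : Set E := U ∩ fderiv ℝ f ⁻¹' Set.range ((↑) : (E ≃L[ℝ] G) → E →L[ℝ] G)
  have hW : IsOpen W :=
    (hf.continuousOn_fderiv_of_isOpen hU (by simp)).isOpen_inter_preimage hU
      ContinuousLinearEquiv.isOpen
  have hpW : p ∈ W := ⟨hp, f', hf'.fderiv.symm⟩
  refine ⟨e₀.restrOpen W hW, ⟨hfp.mem_toOpenPartialHomeomorph_source hf' (by simp), hpW⟩,
    fun x hx => hx.2.1, fun x => rfl, ?_⟩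
  intro y hy
  have hx := (e₀.restrOpen W hW).map_target hy
  obtain ⟨g, hg⟩ := hx.2.2
  have hd : ContDiffAt ℝ ∞ f ((e₀.restrOpen W hW).symm y) := hf.contDiffAt (hU.mem_nhds hx.2.1)
  refine ((e₀.restrOpen W hW).contDiffAt_symm hy (f₀' := g) ?_ hd).contDiffWithinAt
  rw [hg]
  exact (hd.differentiableAt (by simp)).hasFDerivAt

/-- The time interval on which rescaled integral curves are parametrized. -/
abbrev timeInterval : Set ℝ := Set.Icc (-1) 1

/-- The primitive vanishing at `0` of a continuous curve on `[-1, 1]`. -/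
def primitive : C(timeInterval, E) →L[ℝ] C(timeInterval, E) :=
  LinearMap.mkContinuous
    { toFun := fun γ => ⟨fun s => ∫ u in (0 : ℝ)..s, Set.IccExtend (by norm_num) γ u,
        (intervalIntegral.continuous_primitive
          (fun a b => (γ.continuous.Icc_extend').intervalIntegrable a b) 0).comp
            continuous_subtype_val⟩
      map_add' := fun γ η => by
        ext s
        exact intervalIntegral.integral_add (γ.continuous.Icc_extend'.intervalIntegrable _ _)
          (η.continuous.Icc_extend'.intervalIntegrable _ _)
      map_smul' := fun c γ => by
        ext s
        exact intervalIntegral.integral_smul c _ } 1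
    (by
      intro γ
      rw [one_mul, ContinuousMap.norm_le _ (norm_nonneg γ)]
      intro s
      have hs : |(s : ℝ)| ≤ 1 := abs_le.2 s.2
      have h := intervalIntegral.norm_integral_le_of_norm_le_const (a := (0 : ℝ)) (b := s)
        (f := Set.IccExtend (by norm_num) γ) (C := ‖γ‖) (fun u _ => γ.norm_coe_le_norm _)
      simp only [sub_zero] at h
      exact h.trans (mul_le_of_le_one_right (norm_nonneg _) hs))

lemma primitive_apply (γ : C(timeInterval, E)) (s : timeInterval) :
    primitive γ s = ∫ u in (0 : ℝ)..s, Set.IccExtend (by norm_num) γ u := rfl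

/-- The curve `γ - y - ε ∫ F ∘ γ`, as a function of `(ε, y, γ)`. It vanishes iff `γ` starts at `y` at
time `0` and `γ' = ε F ∘ γ`. -/
def curveDefect (F : E → E) (hF : Continuous F) (z : ℝ × E × C(timeInterval, E)) :
    C(timeInterval, E) :=
  z.2.2 - ContinuousLinearMap.const ℝ timeInterval z.2.1 - z.1 • primitive (superpose F hF z.2.2)

lemma contDiff_curveDefect (F : E → E) (hF : ContDiff ℝ ∞ F) :
    ContDiff ℝ ∞ (curveDefect F hF.continuous) := by
  have h1 : ContDiff ℝ ∞ fun z : ℝ × E × C(timeInterval, E) =>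
      superpose F hF.continuous z.2.2 :=
    (contDiff_superpose F hF).comp (contDiff_snd.comp contDiff_snd)
  exact ((contDiff_snd.comp contDiff_snd).sub
    ((ContinuousLinearMap.const ℝ timeInterval).contDiff.comp (contDiff_fst.comp contDiff_snd))).sub
      (contDiff_fst.smul (primitive.contDiff.comp h1))

/-- Rescaling time by a factor `σ ∈ [-1, 1]`. -/
def rescale (σ : timeInterval) (γ : C(timeInterval, E)) : C(timeInterval, E) :=
  ⟨fun s => γ ⟨σ * s, abs_le.1 (by
    rw [abs_mul]
    exact mul_le_one₀ (abs_le.2 σ.2) (abs_nonneg _) (abs_le.2 s.2))⟩, by fun_prop⟩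

lemma curveDefect_rescale (F : E → E) (hF : Continuous F) (σ : timeInterval) {ε : ℝ} {y : E}
    {γ : C(timeInterval, E)} (h : curveDefect F hF (ε, y, γ) = 0) :
    curveDefect F hF (σ * ε, y, rescale σ γ) = 0 := by
  ext s
  have hs : (σ * s : ℝ) ∈ timeInterval := abs_le.1 (by
    rw [abs_mul]
    exact mul_le_one₀ (abs_le.2 σ.2) (abs_nonneg _) (abs_le.2 s.2))
  have h1 := DFunLike.congr_fun h ⟨σ * s, hs⟩
  simp only [curveDefect, ContinuousMap.sub_apply, ContinuousMap.smul_apply, primitive_apply,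
    ContinuousLinearMap.const_apply_apply, ContinuousMap.zero_apply] at h1 ⊢
  have h2 : (σ : ℝ) • ∫ u in (0 : ℝ)..s,
      Set.IccExtend (by norm_num) (superpose F hF (rescale σ γ)) u =
      ∫ u in (0 : ℝ)..(σ * s), Set.IccExtend (by norm_num) (superpose F hF γ) u := by
    have h3 := intervalIntegral.smul_integral_comp_mul_left (a := 0) (b := (s : ℝ))
      (Set.IccExtend (by norm_num) (superpose F hF γ)) (σ : ℝ)
    rw [mul_zero] at h3
    rw [← h3]
    congr 1
    refine intervalIntegral.integral_congr fun u hu => ?_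
    have hu' : u ∈ timeInterval :=
      (Set.uIcc_subset_Icc (by norm_num) s.2) hu
    have hσu : (σ * u : ℝ) ∈ timeInterval := abs_le.1 (by
      rw [abs_mul]
      exact mul_le_one₀ (abs_le.2 σ.2) (abs_nonneg _) (abs_le.2 hu'))
    simp only [Set.IccExtend_of_mem _ _ hu', Set.IccExtend_of_mem _ _ hσu]
    rfl
  rw [mul_comm (σ : ℝ) ε, mul_smul, h2]
  exact h1

/-- Local flow of a smooth vector field, jointly smooth in time and initial point. The curves solve
`curveDefect = 0`, and the derivative of this equation in `γ` is the identity at `ε = 0`, so the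
inverse function theorem gives a solution `Γ (ε, y)` depending smoothly on `ε` and `y`. The flow is
its value at the end of the time interval. Local uniqueness makes all `Γ (t, y)` reparametrizations
of one curve, which gives the differential equation in `t`. -/
theorem exists_smooth_flow [CompleteSpace E] (F : E → E) (hF : ContDiff ℝ ∞ F) (p : E) :
    ∃ (θ : ℝ × E → E) (r : ℝ), 0 < r ∧
      ContDiffOn ℝ ∞ θ (Metric.ball 0 r ×ˢ Metric.ball p r) ∧
      ∀ y ∈ Metric.ball p r, θ (0, y) = y ∧
        ∀ t ∈ Metric.ball (0 : ℝ) r, HasDerivAt (fun s => θ (s, y)) (F (θ (t, y))) t := by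
  let Ω : ℝ × E × C(timeInterval, E) → ℝ × E × C(timeInterval, E) :=
    fun z => (z.1, z.2.1, curveDefect F hF.continuous z)
  have hΩ : ContDiff ℝ ∞ Ω := contDiff_fst.prodMk
    ((contDiff_fst.comp contDiff_snd).prodMk (contDiff_curveDefect F hF))
  let z₀ : ℝ × E × C(timeInterval, E) := (0, p, ContinuousLinearMap.const ℝ timeInterval p)
  let L : (ℝ × E × C(timeInterval, E)) ≃L[ℝ] ℝ × E × C(timeInterval, E) :=
    (ContinuousLinearEquiv.refl ℝ ℝ).skewProd
      ((ContinuousLinearEquiv.refl ℝ E).skewProd (ContinuousLinearEquiv.refl ℝ _)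
        (-ContinuousLinearMap.const ℝ timeInterval))
      ((ContinuousLinearMap.inr ℝ E C(timeInterval, E)).comp
        ((ContinuousLinearMap.toSpanSingleton ℝ
          (-primitive (superpose F hF.continuous (ContinuousLinearMap.const ℝ timeInterval p))))))
  have hL : HasFDerivAt Ω (L : _ →L[ℝ] _) z₀ := by
    have h1 : HasFDerivAt (fun z : ℝ × E × C(timeInterval, E) => z.1)
        (ContinuousLinearMap.fst ℝ _ _) z₀ := hasFDerivAt_fst
    have h2 : HasFDerivAt (fun z : ℝ × E × C(timeInterval, E) => z.2)
        (ContinuousLinearMap.snd ℝ _ _) z₀ := hasFDerivAt_snd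
    have h3 : DifferentiableAt ℝ (fun z : ℝ × E × C(timeInterval, E) =>
        primitive (superpose F hF.continuous z.2.2)) z₀ :=
      (primitive.contDiff.comp ((contDiff_superpose F hF).comp
        (contDiff_snd.comp contDiff_snd))).contDiffAt.differentiableAt (n := ∞) (by simp)
    have h4 := h1.prodMk (h2.fst.prodMk
      ((h2.snd.sub ((ContinuousLinearMap.const ℝ timeInterval).hasFDerivAt.comp z₀ h2.fst)).sub
        (h1.smul h3.hasFDerivAt)))
    -- the term `ε • ∫ F ∘ γ` contributes only through `ε`, as `ε = 0` at the base point
    refine h4.congr_fderiv ?_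
    ext z <;> simp [L, z₀]
  obtain ⟨e, hz₀, -, heΩ, he⟩ := exists_openPartialHomeomorph_of_hasFDerivAt_equiv isOpen_univ
    hΩ.contDiffOn (Set.mem_univ z₀) L hL
  have hΩz₀ : Ω z₀ = (0, p, 0) := by
    simp [Ω, z₀, curveDefect]
  let ι : ℝ × E → ℝ × E × C(timeInterval, E) := fun q => (q.1, q.2, 0)
  have hι : ContDiff ℝ ∞ ι := contDiff_fst.prodMk (contDiff_snd.prodMk contDiff_const)
  let Γ : ℝ × E → C(timeInterval, E) := fun q => (e.symm (ι q)).2.2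
  let T : Set (ℝ × E) := ι ⁻¹' e.target
  have hT : IsOpen T := e.open_target.preimage hι.continuous
  have hpT : ((0 : ℝ), p) ∈ T := by
    have := e.map_source hz₀
    rwa [heΩ, hΩz₀] at this
  have hΓ : ContDiffOn ℝ ∞ Γ T :=
    (contDiff_snd.comp contDiff_snd).comp_contDiffOn (he.comp hι.contDiffOn (fun q hq => hq))
  have hΓ0 : Γ (0, p) = ContinuousLinearMap.const ℝ timeInterval p := by
    have : e.symm (ι (0, p)) = z₀ := by
      rw [← e.left_inv hz₀, heΩ, hΩz₀]
    simp only [Γ, this]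
    rfl
  have hsymm : ∀ q ∈ T, e.symm (ι q) = (q.1, q.2, Γ q) ∧
      curveDefect F hF.continuous (q.1, q.2, Γ q) = 0 := by
    intro q hq
    have h1 := e.right_inv hq
    rw [heΩ] at h1
    have h2 : e.symm (ι q) = (q.1, q.2, Γ q) := by
      refine Prod.ext ?_ (Prod.ext ?_ rfl)
      · exact congrArg (fun z => z.1) h1
      · exact congrArg (fun z => z.2.1) h1
    refine ⟨h2, ?_⟩
    rw [h2] at h1
    exact congrArg (fun z => z.2.2) h1
  obtain ⟨δ, hδ, hδs⟩ := Metric.mem_nhds_iff.1 (e.open_source.mem_nhds hz₀)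
  have hnear : ∀ᶠ q in nhds ((0 : ℝ), p), q ∈ T ∧
      dist (Γ q) (ContinuousLinearMap.const ℝ timeInterval p) < δ := by
    refine (hT.eventually_mem hpT).and ?_
    have := (hΓ.contDiffAt (hT.mem_nhds hpT)).continuousAt
    rw [← hΓ0]
    exact this.eventually (Metric.ball_mem_nhds _ hδ)
  obtain ⟨r₀, hr₀, hball⟩ := Metric.eventually_nhds_iff_ball.1 hnear
  let r := min r₀ δ
  have hr : 0 < r := lt_min hr₀ hδ
  have hbox : ∀ t y, |t| < r → dist y p < r → (t, y) ∈ T ∧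
      dist (Γ (t, y)) (ContinuousLinearMap.const ℝ timeInterval p) < δ := by
    intro t y ht hy
    refine hball _ ?_
    rw [Metric.mem_ball, Prod.dist_eq, max_lt_iff]
    exact ⟨by simpa [Real.dist_eq] using ht.trans_le (min_le_left _ _),
      hy.trans_le (min_le_left _ _)⟩
  have hresc : ∀ (σ : timeInterval) (t : ℝ) (y : E), |t| < r → dist y p < r →
      Γ (σ * t, y) = rescale σ (Γ (t, y)) := by
    intro σ t y ht hy
    obtain ⟨hm, hd⟩ := hbox t y ht hy
    have hσ : |(σ : ℝ)| ≤ 1 := abs_le.2 σ.2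
    have hσt : |σ * t| < r := by
      rw [abs_mul]
      exact (mul_le_of_le_one_left (abs_nonneg _) hσ).trans_lt ht
    have hz : ((σ * t, y, rescale σ (Γ (t, y))) : ℝ × E × C(timeInterval, E)) ∈ e.source := by
      refine hδs ?_
      rw [Metric.mem_ball, Prod.dist_eq, Prod.dist_eq, max_lt_iff, max_lt_iff]
      refine ⟨by simpa [Real.dist_eq, z₀] using hσt.trans_le (min_le_right _ _),
        hy.trans_le (min_le_right _ _), ?_⟩
      rw [ContinuousMap.dist_lt_iff hδ]
      intro s
      exact (ContinuousMap.dist_apply_le_dist (f := Γ (t, y))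
        (g := ContinuousLinearMap.const ℝ timeInterval p) _).trans_lt hd
    have h1 := e.left_inv hz
    have h2 := curveDefect_rescale F hF.continuous σ (hsymm _ hm).2
    rw [heΩ] at h1
    simp only [Ω, h2] at h1
    exact congrArg (fun z => z.2.2) h1
  let one : timeInterval := ⟨1, by norm_num⟩
  refine ⟨fun q => Γ q one, r / 2, by positivity, ?_, ?_⟩
  · refine (ContinuousMap.evalCLM ℝ one).contDiff.comp_contDiffOn (hΓ.mono ?_)
    rintro ⟨t, y⟩ ⟨ht, hy⟩
    refine (hbox t y ?_ ?_).1
    · have := mem_ball_zero_iff.1 ht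
      rw [Real.norm_eq_abs] at this
      linarith
    · have := Metric.mem_ball.1 hy
      linarith
  · intro y hy
    have hyr : dist y p < r := by
      have := Metric.mem_ball.1 hy
      linarith
    have hr2 : |r / 2| < r := by rw [abs_of_pos (by positivity)]; linarith
    set γ := Γ (r / 2, y) with hγ
    have hdef := (hsymm _ (hbox _ _ hr2 hyr).1).2
    -- all curves are reparametrizations of the curve of the largest time scale
    have hval : ∀ t : ℝ, |t| ≤ r / 2 → Γ (t, y) one =
        y + (r / 2) • ∫ u in (0 : ℝ)..(t / (r / 2)),
          Set.IccExtend (by norm_num) (superpose F hF.continuous γ) u := by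
      intro t ht
      have hσ : t / (r / 2) ∈ timeInterval := by
        refine abs_le.1 ?_
        rw [abs_div, abs_of_pos (half_pos hr)]
        exact (div_le_one (half_pos hr)).2 ht
      have h1 := hresc ⟨t / (r / 2), hσ⟩ (r / 2) y hr2 hyr
      have h2 := DFunLike.congr_fun hdef ⟨t / (r / 2), hσ⟩
      simp only [curveDefect, ContinuousMap.sub_apply, ContinuousMap.smul_apply, primitive_apply,
        ContinuousLinearMap.const_apply_apply, ContinuousMap.zero_apply] at h2
      rw [div_mul_cancel₀ _ (half_pos hr).ne'] at h1
      rw [h1]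
      simp only [rescale, ContinuousMap.coe_mk, one, mul_one]
      rw [sub_sub, sub_eq_zero] at h2
      exact h2
    refine ⟨by simpa using hval 0 (by simpa using (half_pos hr).le), ?_⟩
    intro t ht
    have ht' : |t| < r / 2 := by simpa using ht
    have hev : (fun s => Γ (s, y) one) =ᶠ[nhds t]
        fun s => y + (r / 2) • ∫ u in (0 : ℝ)..(s / (r / 2)),
          Set.IccExtend (by norm_num) (superpose F hF.continuous γ) u := by
      filter_upwards [(continuous_abs.isOpen_preimage _ isOpen_Iio).mem_nhds
        (show t ∈ abs ⁻¹' Set.Iio (r / 2) from ht')] with s hs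
      exact hval s (le_of_lt hs)
    have hσ : t / (r / 2) ∈ timeInterval := by
      refine abs_le.1 ?_
      rw [abs_div, abs_of_pos (half_pos hr)]
      exact (div_le_one (half_pos hr)).2 ht'.le
    have hcont : Continuous (Set.IccExtend (by norm_num : (-1 : ℝ) ≤ 1)
      (superpose F hF.continuous γ)) := (superpose F hF.continuous γ).continuous.Icc_extend'
    have hint := intervalIntegral.integral_hasDerivAt_right
      (hcont.intervalIntegrable 0 (t / (r / 2)))
      (hcont.stronglyMeasurableAtFilter _ _) hcont.continuousAt
    have hlin : HasDerivAt (fun s : ℝ => s / (r / 2)) (1 / (r / 2)) t :=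
      (hasDerivAt_id t).div_const _
    have hd := ((hint.scomp t hlin).const_smul (r / 2)).const_add y
    refine (hd.congr_of_eventuallyEq hev).congr_deriv ?_
    have h1 := hresc ⟨t / (r / 2), hσ⟩ (r / 2) y hr2 hyr
    rw [div_mul_cancel₀ _ (half_pos hr).ne'] at h1
    rw [smul_smul, mul_one_div_cancel (half_pos hr).ne', one_smul, Set.IccExtend_of_mem _ _ hσ]
    simp only [h1]
    simp [superpose, rescale, one, hγ]

/-- A field smooth near `p` agrees near `p` with a globally smooth one. -/
lemma exists_contDiff_eventuallyEq [FiniteDimensional ℝ E] {F : E → E} {U : Set E}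
    (hU : IsOpen U) (hF : ContDiffOn ℝ ∞ F U) {p : E} (hp : p ∈ U) :
    ∃ G : E → E, ContDiff ℝ ∞ G ∧ G =ᶠ[nhds p] F := by
  obtain ⟨ρ, hρ, hρU⟩ := Metric.nhds_basis_closedBall.mem_iff.1 (hU.mem_nhds hp)
  let χ : ContDiffBump p := ⟨ρ / 2, ρ, half_pos hρ, half_lt_self hρ⟩
  have hχ : tsupport χ ⊆ U := χ.tsupport_eq.subset.trans hρU
  refine ⟨fun x => χ x • F x, contDiff_iff_contDiffAt.2 fun x => ?_, ?_⟩
  · by_cases hx : x ∈ U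
    · exact χ.contDiff.contDiffAt.smul (hF.contDiffAt (hU.mem_nhds hx))
    · have h0 : (fun x => χ x • F x) =ᶠ[nhds x] fun _ => 0 := by
        filter_upwards [notMem_tsupport_iff_eventuallyEq.1 fun h => hx (hχ h)] with z hz
        rw [hz, Pi.zero_apply, zero_smul]
      exact contDiffAt_const.congr_of_eventuallyEq h0
  · filter_upwards [χ.eventuallyEq_one] with x hx
    rw [hx, Pi.one_apply, one_smul]

/-- A smooth vector field that does not vanish at `p` is constant in suitable coordinates
near `p`: time along the flow and the initial point on a transversal hyperplane. -/
theorem exists_flowBox [FiniteDimensional ℝ E] {F : E → E} {U : Set E} (hU : IsOpen U)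
    (hF : ContDiffOn ℝ ∞ F U) {p : E} (hp : p ∈ U) (hFp : F p ≠ 0) :
    ∃ Φ : OpenPartialHomeomorph E E, p ∈ Φ.source ∧ Φ.source ⊆ U ∧
      ContDiffOn ℝ ∞ Φ Φ.source ∧ ContDiffOn ℝ ∞ Φ.symm Φ.target ∧
      ∀ y ∈ Φ.target, fderiv ℝ Φ.symm y (F p) = F (Φ.symm y) := by
  have : CompleteSpace E := FiniteDimensional.complete ℝ E
  obtain ⟨G, hG, hGF⟩ := exists_contDiff_eventuallyEq hU hF hp
  obtain ⟨N, hNp, hN⟩ := mem_nhds_iff.1 (Filter.inter_mem hGF (hU.mem_nhds hp)) |>.imp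
    fun N h => And.intro (And.intro h.2.1 h.2.2) h.1
  obtain ⟨θ, r, hr, hθ, hflow⟩ := exists_smooth_flow G hG p
  obtain ⟨ℓ, hℓ⟩ := SeparatingDual.exists_eq_one (R := ℝ) hFp
  set w := F p with hw
  let S : E → ℝ × E := fun x => (ℓ (x - p), x - ℓ (x - p) • w)
  have hS : ContDiff ℝ ∞ S := by fun_prop
  have hSp : S p = (0, p) := by simp [S]
  let B : Set (ℝ × E) := Metric.ball 0 r ×ˢ Metric.ball p r
  have hB : IsOpen B := Metric.isOpen_ball.prod Metric.isOpen_ball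
  have hpB : S p ∈ B := by
    rw [hSp]
    exact ⟨Metric.mem_ball_self hr, Metric.mem_ball_self hr⟩
  have hθS : ContDiffOn ℝ ∞ (θ ∘ S) (S ⁻¹' B) := hθ.comp hS.contDiffOn fun x hx => hx
  have hO₁ : IsOpen (S ⁻¹' B) := hB.preimage hS.continuous
  have hθSp : (θ ∘ S) p = p := by
    simp only [Function.comp, hSp]
    exact (hflow p (Metric.mem_ball_self hr)).1
  let O : Set E := S ⁻¹' B ∩ (θ ∘ S) ⁻¹' N
  have hO : IsOpen O := hθS.continuousOn.isOpen_inter_preimage hO₁ hNp.1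
  have hpO : p ∈ O := ⟨hpB, by rw [Set.mem_preimage, hθSp]; exact hNp.2⟩
  -- translation along `w` is translation of the time variable
  have hline : ∀ x ∈ S ⁻¹' B, fderiv ℝ (θ ∘ S) x w = G ((θ ∘ S) x) := by
    intro x hx
    have h1 : HasFDerivAt (θ ∘ S) (fderiv ℝ (θ ∘ S) x) x :=
      ((hθS.contDiffAt (hO₁.mem_nhds hx)).differentiableAt (by simp)).hasFDerivAt
    have h2 : HasDerivAt (fun s : ℝ => x + s • w) w 0 := by
      simpa using ((hasDerivAt_id (0 : ℝ)).smul_const w).const_add x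
    have h3 := h1.comp_hasDerivAt_of_eq (0 : ℝ) h2 (by simp)
    have h4 : (θ ∘ S) ∘ (fun s : ℝ => x + s • w) =
        fun s => θ (s + ℓ (x - p), x - ℓ (x - p) • w) := by
      funext s
      have h5 : ℓ (x + s • w - p) = s + ℓ (x - p) := by
        rw [add_sub_right_comm, map_add, map_smul, hℓ, smul_eq_mul, mul_one, add_comm]
      simp only [Function.comp, S, h5]
      congr 2
      rw [add_smul]
      abel
    rw [h4] at h3
    have h6 := (hflow _ hx.2).2 _ hx.1
    have h7 : HasDerivAt (fun s : ℝ => θ (s + ℓ (x - p), x - ℓ (x - p) • w))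
        (G ((θ ∘ S) x)) 0 := by
      refine HasDerivAt.comp_add_const (f := fun s => θ (s, x - ℓ (x - p) • w)) 0 (ℓ (x - p)) ?_
      rw [zero_add]
      exact h6
    exact h3.unique h7
  -- on the transversal hyperplane through `p` the map is the identity
  have hplane : fderiv ℝ (θ ∘ S) p = ContinuousLinearMap.id ℝ E := by
    have h1 : HasFDerivAt (θ ∘ S) (fderiv ℝ (θ ∘ S) p) p :=
      ((hθS.contDiffAt (hO₁.mem_nhds hpB)).differentiableAt (by simp)).hasFDerivAt
    ext x
    let y := x - ℓ x • w
    have hy : ℓ y = 0 := by simp [y, hℓ]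
    have h2 : HasDerivAt (fun s : ℝ => p + s • y) y 0 := by
      simpa using ((hasDerivAt_id (0 : ℝ)).smul_const y).const_add p
    have h3 := h1.comp_hasDerivAt_of_eq (0 : ℝ) h2 (by simp)
    have h4 : (θ ∘ S) ∘ (fun s : ℝ => p + s • y) =ᶠ[nhds 0] fun s => p + s • y := by
      have h5 : ∀ᶠ s : ℝ in nhds 0, p + s • y ∈ Metric.ball p r := by
        have : ContinuousAt (fun s : ℝ => p + s • y) 0 := h2.continuousAt
        exact this.eventually (Metric.isOpen_ball.mem_nhds (by simpa using hr))
      filter_upwards [h5] with s hs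
      have : S (p + s • y) = (0, p + s • y) := by simp [S, hy]
      simp only [Function.comp, this]
      exact (hflow _ hs).1
    have h6 : fderiv ℝ (θ ∘ S) p y = y := h3.unique (h2.congr_of_eventuallyEq h4)
    have h7 : fderiv ℝ (θ ∘ S) p w = w := by
      rw [hline p hpB, hθSp, (hN hNp.2).1, hw]
    have h8 : x = y + ℓ x • w := by simp [y]
    rw [ContinuousLinearMap.id_apply]
    conv_lhs => rw [h8]
    rw [map_add, map_smul, h6, h7, ← h8]
  obtain ⟨e, hpe, heO, hee, hesymm⟩ := exists_openPartialHomeomorph_of_hasFDerivAt_equiv hO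
    (hθS.mono Set.inter_subset_left) hpO (ContinuousLinearEquiv.refl ℝ E) (by
      have h1 := ((hθS.contDiffAt (hO₁.mem_nhds hpB)).differentiableAt (by simp)).hasFDerivAt
      rw [hplane] at h1
      exact h1)
  have hecoe : (e : E → E) = θ ∘ S := funext hee
  refine ⟨e.symm, ?_, ?_, hesymm, ?_, ?_⟩
  · have := e.map_source hpe
    rwa [hee, hθSp] at this
  · intro y hy
    have h1 := (heO (e.map_target hy)).2
    rw [Set.mem_preimage, ← hee, e.right_inv hy] at h1
    exact (hN h1).2
  · rw [e.symm_symm, hecoe]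
    exact hθS.mono fun x hx => (heO hx).1
  · intro x hx
    rw [e.symm_symm, hecoe, hline x (heO hx).1]
    exact (hN (heO hx).2).1

end Flow

/-! ### Functions on the quotient by a constant field, and calculus along vector fields -/

section Straightening

variable {E : Type*} [NormedAddCommGroup E] [NormedSpace ℝ E]

/-- A function that is constant along `w` and has derivative `1` along `Z`, where `Z` is a field
whose class modulo `w` does not change along `w`. It is found in the quotient by `w`, realized on a
hyperplane through `q`, from a flow box for the class of `Z`. -/
theorem exists_function_deriv_zero_one [FiniteDimensional ℝ E] {Z : E → E} {T : Set E}
    (hT : IsOpen T) (hZ : ContDiffOn ℝ ∞ Z T) {q : E} (hq : q ∈ T) {w : E} (hw : w ≠ 0)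
    (hZq : Z q ∉ Submodule.span ℝ {w})
    (hZw : ∀ ℓ : E →L[ℝ] ℝ, ℓ w = 0 → ∀ y ∈ T, fderiv ℝ (fun z => ℓ (Z z)) y w = 0) :
    ∃ (H : E → ℝ) (T' : Set E), IsOpen T' ∧ q ∈ T' ∧ T' ⊆ T ∧ ContDiffOn ℝ ∞ H T' ∧
      ∀ y ∈ T', fderiv ℝ H y w = 0 ∧ fderiv ℝ H y (Z y) = 1 := by
  obtain ⟨ℓ, hℓ⟩ := SeparatingDual.exists_eq_one (R := ℝ) hw
  let Q : E →L[ℝ] E := ContinuousLinearMap.id ℝ E - ℓ.smulRight w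
  have hQ : ∀ x, Q x = x - ℓ x • w := fun x => rfl
  have hQw : Q w = 0 := by simp [hQ, hℓ]
  let F : E → E := fun y => Q (Z y)
  have hF : ContDiffOn ℝ ∞ F T := Q.contDiff.comp_contDiffOn hZ
  have hFq : F q ≠ 0 := by
    intro h
    refine hZq (Submodule.mem_span_singleton.2 ⟨ℓ (Z q), ?_⟩)
    exact (sub_eq_zero.1 h).symm
  have hFd : ∀ y ∈ T, fderiv ℝ F y w = 0 := by
    intro y hy
    by_contra hne
    obtain ⟨m, hm⟩ := SeparatingDual.exists_ne_zero (R := ℝ) hne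
    refine hm ?_
    have h1 := hZw (m.comp Q) (by simp [hQw]) y hy
    have h2 : DifferentiableAt ℝ F y :=
      (hF.contDiffAt (hT.mem_nhds hy)).differentiableAt (by simp)
    have h3 : fderiv ℝ (fun z => m (F z)) y = m.comp (fderiv ℝ F y) :=
      (m.hasFDerivAt.comp y h2.hasFDerivAt).fderiv
    have h4 : (fun z => (m.comp Q) (Z z)) = fun z => m (F z) := rfl
    rw [h4, h3] at h1
    exact h1
  obtain ⟨Φ, hqΦ, hΦT, hΦ, hΦs, hΦd⟩ := exists_flowBox hT hF hq hFq
  have hΦd' : ∀ x ∈ Φ.source, fderiv ℝ Φ x (F x) = F q := by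
    intro x hx
    have h1 := hΦd (Φ x) (Φ.map_source hx)
    rw [Φ.left_inv hx] at h1
    have h2 : HasFDerivAt Φ (fderiv ℝ Φ x) (Φ.symm (Φ x)) := by
      rw [Φ.left_inv hx]
      exact ((hΦ.contDiffAt (Φ.open_source.mem_nhds hx)).differentiableAt (by simp)).hasFDerivAt
    have h3 : HasFDerivAt Φ.symm (fderiv ℝ Φ.symm (Φ x)) (Φ x) :=
      ((hΦs.contDiffAt (Φ.open_target.mem_nhds (Φ.map_source hx))).differentiableAt
        (by simp)).hasFDerivAt
    have h4 := h2.comp (Φ x) h3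
    have h5 : Φ ∘ Φ.symm =ᶠ[nhds (Φ x)] id := by
      filter_upwards [Φ.open_target.mem_nhds (Φ.map_source hx)] with z hz using Φ.right_inv hz
    have h6 := h4.unique ((hasFDerivAt_id (Φ x)).congr_of_eventuallyEq h5)
    have h7 := DFunLike.congr_fun h6 (F q)
    rwa [ContinuousLinearMap.comp_apply, h1] at h7
  obtain ⟨m, hm⟩ := SeparatingDual.exists_eq_one (R := ℝ) hFq
  let P : E → E := fun y => q + Q (y - q)
  have hPs : ContDiff ℝ ∞ P := by fun_prop
  have hPq : P q = q := by simp [P]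
  have hPd : ∀ y, HasFDerivAt P Q y := fun y => by
    have := (Q.hasFDerivAt.comp y ((hasFDerivAt_id y).sub_const q)).const_add q
    exact this
  obtain ⟨r, hr, hball⟩ := Metric.isOpen_iff.1 (hT.inter Φ.open_source) q ⟨hq, hqΦ⟩
  let T' : Set E := Metric.ball q r ∩ P ⁻¹' Metric.ball q r
  have hT' : IsOpen T' := Metric.isOpen_ball.inter (Metric.isOpen_ball.preimage hPs.continuous)
  have hFP : ∀ y ∈ T', F (P y) = F y := by
    intro y hy
    let c : ℝ → E := fun s => y - s • (ℓ (y - q) • w)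
    have hc0 : c 0 = y := by simp [c]
    have hc1 : c 1 = P y := by
      simp only [c, P, hQ, one_smul]
      abel
    have hcm : ∀ s ∈ Set.Icc (0 : ℝ) 1, c s ∈ T := by
      intro s hs
      have h1 : c s = AffineMap.lineMap y (P y) s := by
        rw [AffineMap.lineMap_apply_module', ← hc1]
        simp only [c, one_smul, sub_sub_cancel_left, smul_neg]
        abel
      rw [h1]
      exact (hball ((convex_ball q r).lineMap_mem hy.1 hy.2 hs)).1
    have hcd : ∀ s ∈ Set.Icc (0 : ℝ) 1, HasDerivAt (F ∘ c) 0 s := by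
      intro s hs
      have h1 : HasDerivAt c (-(ℓ (y - q) • w)) s := by
        have := ((hasDerivAt_id s).smul_const (ℓ (y - q) • w)).const_sub y
        simpa only [one_smul, id] using this
      have h2 := ((hF.contDiffAt (hT.mem_nhds (hcm s hs))).differentiableAt
        (by simp)).hasFDerivAt.comp_hasDerivAt s h1
      rwa [map_neg, map_smul, hFd _ (hcm s hs), smul_zero, neg_zero] at h2
    have h := constant_of_has_deriv_right_zero
      (fun s hs => (hcd s hs).continuousAt.continuousWithinAt)
      (fun s hs => (hcd s ⟨hs.1, hs.2.le⟩).hasDerivWithinAt) 1 (by norm_num)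
    simpa [hc0, hc1] using h
  refine ⟨fun y => m (Φ (P y)), T', hT', ?_, fun y hy => (hball hy.1).1, ?_, ?_⟩
  · exact ⟨Metric.mem_ball_self hr, by
      rw [Set.mem_preimage, hPq]
      exact Metric.mem_ball_self hr⟩
  · exact m.contDiff.comp_contDiffOn (hΦ.comp hPs.contDiffOn fun y hy => (hball hy.2).2)
  · intro y hy
    have hPy : P y ∈ Φ.source := (hball hy.2).2
    have h1 : HasFDerivAt (fun y => m (Φ (P y))) (m.comp ((fderiv ℝ Φ (P y)).comp Q)) y :=
      m.hasFDerivAt.comp y ((((hΦ.contDiffAt (Φ.open_source.mem_nhds hPy)).differentiableAt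
        (by simp)).hasFDerivAt).comp y (hPd y))
    rw [h1.fderiv]
    refine ⟨by simp [hQw], ?_⟩
    have h2 : Q (Z y) = F (P y) := (hFP y hy).symm
    simp only [ContinuousLinearMap.comp_apply, h2, hΦd' _ hPy, hm]

end Straightening

section Calculus

variable {M : Type*} [TopologicalSpace M] [ChartedSpace (EuclideanSpace ℝ (Fin 3)) M]

/-- The derivative of a smooth function along a smooth field is smooth: it is the second component
of the tangent map composed with the field. -/
lemma contMDiffOn_mvfderiv_apply [IsManifold (𝓡 3) ∞ M]
    {F : Type*} [NormedAddCommGroup F] [NormedSpace ℝ F]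
    {f : M → F} {X : ∀ x : M, TangentSpace (𝓡 3) x} {U : Set M} (hU : IsOpen U)
    (hX : SmoothFieldOn X U) (hf : ContMDiffOn (𝓡 3) 𝓘(ℝ, F) ∞ f U) :
    ContMDiffOn (𝓡 3) 𝓘(ℝ, F) ∞ (fun x => mvfderiv (𝓡 3) f x (X x)) U := by
  have h1 := hf.contMDiffOn_tangentMapWithin (m := ∞) (by simp) hU.uniqueMDiffOn
  have h2 := h1.comp hX fun x hx => hx
  have h3 := (contMDiff_snd_tangentBundle_modelSpace F 𝓘(ℝ, F) (n := ∞)).comp_contMDiffOn h2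
  refine h3.congr fun x hx => ?_
  simp only [Function.comp, tangentMapWithin, mfderivWithin_of_isOpen hU hx]
  rfl

lemma SmoothOn.along [IsManifold (𝓡 3) ∞ M] {f : M → ℝ} {X : ∀ x : M, TangentSpace (𝓡 3) x}
    {U : Set M} (hU : IsOpen U) (hX : SmoothFieldOn X U) (hf : SmoothOn f U) :
    SmoothOn (along X f) U :=
  contMDiffOn_mvfderiv_apply hU hX hf

lemma SmoothOn.mdifferentiableAt {f : M → ℝ} {U : Set M} (hU : IsOpen U) (hf : SmoothOn f U)
    {x : M} (hx : x ∈ U) : MDifferentiableAt (𝓡 3) 𝓘(ℝ, ℝ) f x :=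
  (hf.contMDiffAt (hU.mem_nhds hx)).mdifferentiableAt (by simp)

lemma along_congr {f g : M → ℝ} (X : ∀ x : M, TangentSpace (𝓡 3) x) {x : M}
    (h : f =ᶠ[nhds x] g) : along X f x = along X g x := by
  have h1 : mfderiv (𝓡 3) 𝓘(ℝ, ℝ) f x = mfderiv (𝓡 3) 𝓘(ℝ, ℝ) g x := h.mfderiv_eq
  exact DFunLike.congr_fun h1 (X x)

lemma along_mul {f g : M → ℝ} (X : ∀ x : M, TangentSpace (𝓡 3) x) {x : M}
    (hf : MDifferentiableAt (𝓡 3) 𝓘(ℝ, ℝ) f x) (hg : MDifferentiableAt (𝓡 3) 𝓘(ℝ, ℝ) g x) :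
    along X (fun y => f y * g y) x = f x * along X g x + g x * along X f x := by
  simp only [along, diff, mvfderiv_fun_mul hf hg]
  rfl

lemma along_add {f g : M → ℝ} (X : ∀ x : M, TangentSpace (𝓡 3) x) {x : M}
    (hf : MDifferentiableAt (𝓡 3) 𝓘(ℝ, ℝ) f x) (hg : MDifferentiableAt (𝓡 3) 𝓘(ℝ, ℝ) g x) :
    along X (fun y => f y + g y) x = along X f x + along X g x := by
  simp only [along, diff, mvfderiv_fun_add hf hg]
  rfl

lemma along_sub {f g : M → ℝ} (X : ∀ x : M, TangentSpace (𝓡 3) x) {x : M}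
    (hf : MDifferentiableAt (𝓡 3) 𝓘(ℝ, ℝ) f x) (hg : MDifferentiableAt (𝓡 3) 𝓘(ℝ, ℝ) g x) :
    along X (fun y => f y - g y) x = along X f x - along X g x := by
  simp only [along, diff, mvfderiv_fun_sub hf hg]
  rfl

/-- Chain rule for a differentiable map into a normed space followed by a function on it. -/
lemma along_comp {F : Type*} [NormedAddCommGroup F] [NormedSpace ℝ F] {Φ : M → F} {h : F → ℝ}
    (X : ∀ x : M, TangentSpace (𝓡 3) x) {x : M} (hh : DifferentiableAt ℝ h (Φ x))
    (hΦ : MDifferentiableAt (𝓡 3) 𝓘(ℝ, F) Φ x) :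
    along X (fun y => h (Φ y)) x = fderiv ℝ h (Φ x) (mvfderiv (𝓡 3) Φ x (X x)) := by
  have h1 := mfderiv_comp (I := 𝓡 3) (I' := 𝓘(ℝ, F)) (I'' := 𝓘(ℝ, ℝ)) x hh.mdifferentiableAt hΦ
  rw [mfderiv_eq_fderiv] at h1
  show mfderiv (𝓡 3) 𝓘(ℝ, ℝ) (h ∘ Φ) x (X x) = _
  rw [h1]
  rfl

end Calculus

/-! ### Lie brackets as commutators, and flow boxes on manifolds -/

lemma two_le_infty : (2 : WithTop ℕ∞) ≤ ∞ := by
  exact WithTop.coe_le_coe.2 (le_top : (2 : ℕ∞) ≤ ⊤)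

section LieBracket

variable {M : Type*} [TopologicalSpace M] [ChartedSpace (EuclideanSpace ℝ (Fin 3)) M]
  [IsManifold (𝓡 3) ∞ M]

/-- A vector field in the coordinates of the preferred chart at `x`. -/
abbrev chartField (X : ∀ x : M, TangentSpace (𝓡 3) x) (x : M) :
    EuclideanSpace ℝ (Fin 3) → EuclideanSpace ℝ (Fin 3) :=
  VectorField.mpullbackWithin 𝓘(ℝ, EuclideanSpace ℝ (Fin 3)) (𝓡 3) (extChartAt (𝓡 3) x).symm X
    (Set.range (𝓡 3))

lemma along_extChartAt_symm (X : ∀ x : M, TangentSpace (𝓡 3) x) (x : M) {g : M → ℝ}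
    {z : EuclideanSpace ℝ (Fin 3)} (hz : z ∈ (extChartAt (𝓡 3) x).target)
    (hg : MDifferentiableAt (𝓡 3) 𝓘(ℝ, ℝ) g ((extChartAt (𝓡 3) x).symm z)) :
    along X g ((extChartAt (𝓡 3) x).symm z) =
      fderiv ℝ (g ∘ (extChartAt (𝓡 3) x).symm) z (chartField X x z) := by
  have : IsManifold (𝓡 3) 1 M := IsManifold.of_le (n := ∞) (by simp)
  have h1 := isInvertible_mfderivWithin_extChartAt_symm (I := 𝓡 3) hz
  have h2 : mfderivWithin 𝓘(ℝ, EuclideanSpace ℝ (Fin 3)) (𝓡 3) (extChartAt (𝓡 3) x).symm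
      (Set.range (𝓡 3)) z (chartField X x z) = X ((extChartAt (𝓡 3) x).symm z) :=
    h1.self_apply_inverse _
  have h3 : MDifferentiableWithinAt 𝓘(ℝ, EuclideanSpace ℝ (Fin 3)) (𝓡 3)
      (extChartAt (𝓡 3) x).symm (Set.range (𝓡 3)) z :=
    mdifferentiableWithinAt_extChartAt_symm hz
  have h4 := mfderiv_comp_mfderivWithin z hg h3
    ((𝓡 3).uniqueMDiffOn z (extChartAt_target_subset_range x hz))
  rw [mfderivWithin_eq_fderivWithin, ModelWithCorners.range_eq_univ, fderivWithin_univ] at h4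
  rw [h4]
  rw [ModelWithCorners.range_eq_univ] at h2
  exact (congrArg _ h2).symm

/-- The Lie bracket of vector fields is the commutator of the derivations. -/
theorem along_mlieBracket {X Y : ∀ x : M, TangentSpace (𝓡 3) x} {f : M → ℝ} {U : Set M}
    (hU : IsOpen U) (hX : SmoothFieldOn X U) (hY : SmoothFieldOn Y U) (hf : SmoothOn f U)
    {x : M} (hx : x ∈ U) :
    along (VectorField.mlieBracket (𝓡 3) X Y) f x =
      along X (along Y f) x - along Y (along X f) x := by
  have : IsManifold (𝓡 3) 1 M := IsManifold.of_le (n := ∞) (by simp)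
  have : IsManifold (𝓡 3) 2 M := IsManifold.of_le (n := ∞) two_le_infty
  let φ := extChartAt (𝓡 3) x
  let fh : EuclideanSpace ℝ (Fin 3) → ℝ := f ∘ φ.symm
  have hφx : φ.symm (φ x) = x := extChartAt_to_inv x
  have hfhs : ContDiffAt ℝ ∞ fh (φ x) := by
    have h1 := (contMDiffAt_iff_of_mem_source (mem_chart_source _ x) (mem_chart_source _ (f x))).1
      (hf.contMDiffAt (hU.mem_nhds hx))
    have h2 := h1.2
    rw [ModelWithCorners.range_eq_univ, contDiffWithinAt_univ] at h2
    exact h2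
  have hdiff : ∀ (Z : ∀ x : M, TangentSpace (𝓡 3) x), SmoothFieldOn Z U →
      DifferentiableAt ℝ (chartField Z x) (φ x) := by
    intro Z hZ
    have h1 : MDifferentiableWithinAt (𝓡 3) (𝓡 3).tangent
        (fun x => (⟨x, Z x⟩ : TangentBundle (𝓡 3) M)) Set.univ x :=
      ((hZ.contMDiffAt (hU.mem_nhds hx)).mdifferentiableAt (by simp)).mdifferentiableWithinAt
    have h2 := h1.differentiableWithinAt_mpullbackWithin_vectorField
    have h3 : ∀ (A : EuclideanSpace ℝ (Fin 3) → EuclideanSpace ℝ (Fin 3)) (s : Set _)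
        (y : EuclideanSpace ℝ (Fin 3)), s = Set.univ → DifferentiableWithinAt ℝ A s y →
        DifferentiableAt ℝ A y := by
      rintro A s y rfl h
      exact differentiableWithinAt_univ.1 h
    exact h3 _ _ _ (by rw [Set.preimage_univ, Set.univ_inter, ModelWithCorners.range_eq_univ]) h2
  have hnear : ∀ᶠ z in nhds (φ x), z ∈ φ.target ∧ φ.symm z ∈ U := by
    refine Filter.Eventually.and (extChartAt_target_mem_nhds x) ?_
    refine (continuousAt_extChartAt_symm x).eventually ?_
    rw [hφx]
    exact hU.mem_nhds hx
  have hsecond : ∀ Z W : (∀ x : M, TangentSpace (𝓡 3) x), SmoothFieldOn Z U → SmoothFieldOn W U →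
      along Z (along W f) x = fderiv ℝ (fderiv ℝ fh) (φ x) (chartField Z x (φ x))
        (chartField W x (φ x)) +
        fderiv ℝ fh (φ x) (fderiv ℝ (chartField W x) (φ x) (chartField Z x (φ x))) := by
    intro Z W hZ hW
    have h1 := along_extChartAt_symm Z x (g := along W f) (mem_extChartAt_target x)
      (by rw [extChartAt_to_inv]; exact (SmoothOn.along hU hW hf).mdifferentiableAt hU hx)
    rw [extChartAt_to_inv] at h1
    have h2 : along W f ∘ (extChartAt (𝓡 3) x).symm =ᶠ[nhds (φ x)]
        fun z => fderiv ℝ fh z (chartField W x z) := by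
      filter_upwards [hnear] with z hz
      exact along_extChartAt_symm W x hz.1 (SmoothOn.mdifferentiableAt hU hf hz.2)
    rw [h1, h2.fderiv_eq, fderiv_clm_apply ((hfhs.fderiv_right (m := 1)
      (by rw [one_add_one_eq_two]; exact two_le_infty)).differentiableAt
      one_ne_zero) (hdiff W hW)]
    simp only [add_apply, ContinuousLinearMap.comp_apply,
      ContinuousLinearMap.flip_apply]
    rw [add_comm]
  have hsymm : IsSymmSndFDerivAt ℝ fh (φ x) := hfhs.isSymmSndFDerivAt (by simpa using two_le_infty)
  have hbr : along (VectorField.mlieBracket (𝓡 3) X Y) f x =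
      fderiv ℝ fh (φ x) (VectorField.lieBracket ℝ (chartField X x) (chartField Y x) (φ x)) := by
    have h1 : f =ᶠ[nhds x] fh ∘ φ := by
      filter_upwards [extChartAt_source_mem_nhds (I := 𝓡 3) x] with z hz
      simp only [fh, Function.comp, φ, (extChartAt (𝓡 3) x).left_inv hz]
    rw [along_congr _ h1]
    have h2 := along_comp (VectorField.mlieBracket (𝓡 3) X Y) (Φ := φ) (h := fh) (x := x)
      (hfhs.differentiableAt (by simp)) (mdifferentiableAt_extChartAt (mem_chart_source _ x))
    refine h2.trans (congrArg _ ?_)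
    rw [← VectorField.mlieBracketWithin_univ, VectorField.mlieBracketWithin_apply]
    refine ((isInvertible_mfderiv_extChartAt (I := 𝓡 3)
      (mem_extChartAt_source x)).self_apply_inverse _).trans ?_
    have h3 : ∀ (A B : EuclideanSpace ℝ (Fin 3) → EuclideanSpace ℝ (Fin 3)) (s : Set _)
        (y : EuclideanSpace ℝ (Fin 3)), s = Set.univ →
        VectorField.lieBracketWithin ℝ A B s y = VectorField.lieBracket ℝ A B y := by
      rintro A B s y rfl
      rw [VectorField.lieBracketWithin_univ]
    exact h3 _ _ _ _ (by rw [Set.preimage_univ, Set.univ_inter, ModelWithCorners.range_eq_univ])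
  rw [hbr, hsecond X Y hX hY, hsecond Y X hY hX, VectorField.lieBracket_eq, map_sub,
    hsymm.eq (chartField X x (φ x)) (chartField Y x (φ x))]
  ring

end LieBracket

section FlowBox

variable {M : Type*} [TopologicalSpace M] [ChartedSpace (EuclideanSpace ℝ (Fin 3)) M]

lemma mvfderiv_injective_of_openPartialHomeomorph
    {F : Type*} [NormedAddCommGroup F] [NormedSpace ℝ F] {Φ : OpenPartialHomeomorph M F}
    (hΦ : ContMDiffOn (𝓡 3) 𝓘(ℝ, F) ∞ Φ Φ.source)
    (hΦs : ContMDiffOn 𝓘(ℝ, F) (𝓡 3) ∞ Φ.symm Φ.target) {x : M} (hx : x ∈ Φ.source) :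
    Function.Injective (mvfderiv (𝓡 3) Φ x) := by
  have h1 : HasMFDerivAt (𝓡 3) 𝓘(ℝ, F) Φ x (mfderiv (𝓡 3) 𝓘(ℝ, F) Φ x) :=
    ((hΦ.contMDiffAt (Φ.open_source.mem_nhds hx)).mdifferentiableAt (by simp)).hasMFDerivAt
  have h2 : HasMFDerivAt 𝓘(ℝ, F) (𝓡 3) Φ.symm (Φ x) (mfderiv 𝓘(ℝ, F) (𝓡 3) Φ.symm (Φ x)) :=
    ((hΦs.contMDiffAt (Φ.open_target.mem_nhds (Φ.map_source hx))).mdifferentiableAt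
      (by simp)).hasMFDerivAt
  have h3 := h2.comp x h1
  have h4 : Φ.symm ∘ Φ =ᶠ[nhds x] id := by
    filter_upwards [Φ.open_source.mem_nhds hx] with z hz using Φ.left_inv hz
  have h5 := hasMFDerivAt_unique h3 ((hasMFDerivAt_id x).congr_of_eventuallyEq h4)
  intro a b hab
  have ha := DFunLike.congr_fun h5 a
  have hb := DFunLike.congr_fun h5 b
  exact ha.symm.trans ((congrArg (mfderiv 𝓘(ℝ, F) (𝓡 3) Φ.symm (Φ x)) hab).trans hb)

/-- Smooth coordinates in which a vector field that does not vanish at `p` is constant. -/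
theorem exists_flowBox_manifold [IsManifold (𝓡 3) ∞ M] {X : ∀ x : M, TangentSpace (𝓡 3) x}
    {U : Set M} (hU : IsOpen U) (hX : SmoothFieldOn X U) {p : M} (hp : p ∈ U) (hXp : X p ≠ 0) :
    ∃ (Φ : OpenPartialHomeomorph M (EuclideanSpace ℝ (Fin 3))) (w : EuclideanSpace ℝ (Fin 3)),
      p ∈ Φ.source ∧ Φ.source ⊆ U ∧ w ≠ 0 ∧
      ContMDiffOn (𝓡 3) 𝓘(ℝ, EuclideanSpace ℝ (Fin 3)) ∞ Φ Φ.source ∧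
      ContMDiffOn 𝓘(ℝ, EuclideanSpace ℝ (Fin 3)) (𝓡 3) ∞ Φ.symm Φ.target ∧
      ∀ x ∈ Φ.source, mvfderiv (𝓡 3) Φ x (X x) = w := by
  let c : OpenPartialHomeomorph M (EuclideanSpace ℝ (Fin 3)) :=
    (chartAt (EuclideanSpace ℝ (Fin 3)) p).restrOpen U hU
  have hc : ContMDiffOn (𝓡 3) 𝓘(ℝ, EuclideanSpace ℝ (Fin 3)) ∞ c c.source :=
    (contMDiffOn_chart (I := 𝓡 3) (n := ∞) (x := p)).mono fun x hx => hx.1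
  have hcs : ContMDiffOn 𝓘(ℝ, EuclideanSpace ℝ (Fin 3)) (𝓡 3) ∞ c.symm c.target :=
    (contMDiffOn_chart_symm (I := 𝓡 3) (n := ∞) (x := p)).mono fun y hy => hy.1
  have hpc : p ∈ c.source := ⟨mem_chart_source _ p, hp⟩
  let V : M → EuclideanSpace ℝ (Fin 3) := fun x => mvfderiv (𝓡 3) c x (X x)
  have hV : ContMDiffOn (𝓡 3) 𝓘(ℝ, EuclideanSpace ℝ (Fin 3)) ∞ V c.source :=
    contMDiffOn_mvfderiv_apply c.open_source (hX.mono fun x hx => hx.2) hc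
  have hF : ContDiffOn ℝ ∞ (V ∘ c.symm) c.target :=
    contMDiffOn_iff_contDiffOn.1 (hV.comp hcs fun y hy => c.map_target hy)
  have hVp : V p ≠ 0 := by
    intro h
    refine hXp (mvfderiv_injective_of_openPartialHomeomorph hc hcs hpc ?_)
    rw [map_zero]
    exact h
  obtain ⟨Ψ, hpΨ, hΨc, hΨ, hΨs, hΨd⟩ := exists_flowBox c.open_target hF (c.map_source hpc)
    (by simpa only [Function.comp, c.left_inv hpc] using hVp)
  have hsrc : ∀ x ∈ (c.trans Ψ).source, x ∈ c.source ∧ c x ∈ Ψ.source := fun x hx => by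
    rwa [c.trans_source] at hx
  have htgt : ∀ y ∈ (c.trans Ψ).target, y ∈ Ψ.target ∧ Ψ.symm y ∈ c.target := fun y hy => by
    rwa [c.trans_target] at hy
  refine ⟨c.trans Ψ, V p, by rw [c.trans_source]; exact ⟨hpc, hpΨ⟩, fun x hx => (hsrc x hx).1.2,
    hVp, ?_, ?_, ?_⟩
  · exact (contMDiffOn_iff_contDiffOn.2 hΨ).comp (hc.mono fun x hx => (hsrc x hx).1)
      fun x hx => (hsrc x hx).2
  · exact hcs.comp ((contMDiffOn_iff_contDiffOn.2 hΨs).mono fun y hy => (htgt y hy).1)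
      fun y hy => (htgt y hy).2
  · intro x hx
    obtain ⟨hxc, hxΨ⟩ := hsrc x hx
    have hd : HasFDerivAt Ψ (fderiv ℝ Ψ (c x)) (c x) :=
      ((hΨ.contDiffAt (Ψ.open_source.mem_nhds hxΨ)).differentiableAt (by simp)).hasFDerivAt
    have hds : HasFDerivAt Ψ.symm (fderiv ℝ Ψ.symm (Ψ (c x))) (Ψ (c x)) :=
      ((hΨs.contDiffAt (Ψ.open_target.mem_nhds (Ψ.map_source hxΨ))).differentiableAt
        (by simp)).hasFDerivAt
    have h1 : fderiv ℝ Ψ (c x) (V x) = V p := by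
      have h2 := hΨd (Ψ (c x)) (Ψ.map_source hxΨ)
      simp only [Ψ.left_inv hxΨ, Function.comp, c.left_inv hxc, c.left_inv hpc] at h2
      have h3 := HasFDerivAt.comp (Ψ (c x)) (by rwa [Ψ.left_inv hxΨ]) hds
      have h4 : Ψ ∘ Ψ.symm =ᶠ[nhds (Ψ (c x))] id := by
        filter_upwards [Ψ.open_target.mem_nhds (Ψ.map_source hxΨ)] with z hz using Ψ.right_inv hz
      have h5 := DFunLike.congr_fun
        (h3.unique ((hasFDerivAt_id _).congr_of_eventuallyEq h4)) (V p)
      rwa [ContinuousLinearMap.comp_apply, h2] at h5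
    have h6 := mfderiv_comp (I := 𝓡 3) (I' := 𝓘(ℝ, EuclideanSpace ℝ (Fin 3)))
      (I'' := 𝓘(ℝ, EuclideanSpace ℝ (Fin 3))) x hd.differentiableAt.mdifferentiableAt
      ((hc.contMDiffAt (c.open_source.mem_nhds hxc)).mdifferentiableAt (by simp))
    rw [mfderiv_eq_fderiv] at h6
    exact (DFunLike.congr_fun h6 (X x)).trans h1

end FlowBox

/-! ### Poisson structures of the form `A ∧ e₁` -/

section Poisson

variable {M : Type*} [TopologicalSpace M] [ChartedSpace (EuclideanSpace ℝ (Fin 3)) M]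

lemma SmoothOn.mono {f : M → ℝ} {U V : Set M} (hf : SmoothOn f U) (h : V ⊆ U) : SmoothOn f V :=
  ContMDiffOn.mono hf h

lemma SmoothOn.mul {f g : M → ℝ} {U : Set M} (hf : SmoothOn f U) (hg : SmoothOn g U) :
    SmoothOn (fun x => f x * g x) U := ContMDiffOn.mul hf hg

lemma SmoothOn.add {f g : M → ℝ} {U : Set M} (hf : SmoothOn f U) (hg : SmoothOn g U) :
    SmoothOn (fun x => f x + g x) U := ContMDiffOn.add hf hg

lemma SmoothOn.sub {f g : M → ℝ} {U : Set M} (hf : SmoothOn f U) (hg : SmoothOn g U) :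
    SmoothOn (fun x => f x - g x) U := ContMDiffOn.sub hf hg

lemma SmoothOn.inv {f : M → ℝ} {U : Set M} (hf : SmoothOn f U) (h0 : ∀ x ∈ U, f x ≠ 0) :
    SmoothOn (fun x => (f x)⁻¹) U := fun x hx =>
  ((contDiffAt_inv ℝ (h0 x hx)).contMDiffAt).comp_contMDiffWithinAt x (hf x hx)

lemma SmoothOn.div {f g : M → ℝ} {U : Set M} (hf : SmoothOn f U) (hg : SmoothOn g U)
    (h0 : ∀ x ∈ U, g x ≠ 0) : SmoothOn (fun x => f x / g x) U := by
  simp only [div_eq_mul_inv]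
  exact hf.mul (hg.inv h0)

lemma mdifferentiableAt_mul {f g : M → ℝ} {x : M}
    (hf : MDifferentiableAt (𝓡 3) 𝓘(ℝ, ℝ) f x) (hg : MDifferentiableAt (𝓡 3) 𝓘(ℝ, ℝ) g x) :
    MDifferentiableAt (𝓡 3) 𝓘(ℝ, ℝ) (fun y => f y * g y) x := hf.mul hg

lemma along_log {u : M → ℝ} (X : ∀ x : M, TangentSpace (𝓡 3) x) {x : M}
    (hu : MDifferentiableAt (𝓡 3) 𝓘(ℝ, ℝ) u x) (h0 : u x ≠ 0) :
    along X (fun y => Real.log (u y)) x = along X u x / u x := by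
  rw [along_comp X (Real.differentiableAt_log h0) hu, fderiv_eq_smul_deriv, Real.deriv_log,
    smul_eq_mul, div_eq_mul_inv]
  rfl

lemma IsPoissonOn.mono {𝒥 : BivectorField M} {U V : Set M} (h : IsPoissonOn 𝒥 U) (hVU : V ⊆ U) :
    IsPoissonOn 𝒥 V :=
  ⟨fun W hW => h.smooth W (hW.trans hVU), fun W hW => h.jacobi W (hW.trans hVU)⟩

lemma IsHamiltonianOn.mono {v : ∀ x : M, TangentSpace (𝓡 3) x} {𝒥 : BivectorField M} {H : M → ℝ}
    {U V : Set M} (h : IsHamiltonianOn v 𝒥 H U) (hVU : V ⊆ U) : IsHamiltonianOn v 𝒥 H V :=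
  ⟨h.1.mono hVU, fun x hx => h.2 x (hVU hx)⟩

/-- A bivector field `A ∧ B` satisfies the Jacobi identity when the commutator of `A` and `B` is a
combination of `A` and `B`. -/
theorem isPoissonOn_of_commutator [IsManifold (𝓡 3) ∞ M] {𝒥 : BivectorField M} {V : Set M}
    {A B : ∀ x : M, TangentSpace (𝓡 3) x} (hA : SmoothFieldOn A V) (hB : SmoothFieldOn B V)
    (h𝒥 : ∀ x ∈ V, ∀ a b : Cotangent x, 𝒥 x ![a, b] = a (A x) * b (B x) - a (B x) * b (A x))
    {r c : M → ℝ}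
    (hcomm : ∀ W ⊆ V, IsOpen W → ∀ f : M → ℝ, SmoothOn f W → ∀ x ∈ W,
      along B (along A f) x - along A (along B f) x = r x * along A f x + c x * along B f x) :
    IsPoissonOn 𝒥 V := by
  have hbr : ∀ (f g : M → ℝ), ∀ x ∈ V,
      bracket 𝒥 f g x = along A f x * along B g x - along B f x * along A g x :=
    fun f g x hx => h𝒥 x hx _ _
  refine ⟨fun W hWV hW f g hf hg => ?_, fun W hWV hW f g h hf hg hh x hx => ?_⟩
  · have hAW : SmoothFieldOn A W := hA.mono hWV
    have hBW : SmoothFieldOn B W := hB.mono hWV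
    exact (((hf.along hW hAW).mul (hg.along hW hBW)).sub
      ((hf.along hW hBW).mul (hg.along hW hAW))).congr fun x hx => hbr f g x (hWV hx)
  · have hAW : SmoothFieldOn A W := hA.mono hWV
    have hBW : SmoothFieldOn B W := hB.mono hWV
    have hd : ∀ (X : ∀ x : M, TangentSpace (𝓡 3) x), SmoothFieldOn X W → ∀ k l : M → ℝ,
        SmoothOn k W → SmoothOn l W → along X (bracket 𝒥 k l) x =
          along A k x * along X (along B l) x + along B l x * along X (along A k) x -
          (along B k x * along X (along A l) x + along A l x * along X (along B k) x) := by
      intro X hX k l hk hl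
      have hAk := (hk.along hW hAW).mdifferentiableAt hW hx
      have hBk := (hk.along hW hBW).mdifferentiableAt hW hx
      have hAl := (hl.along hW hAW).mdifferentiableAt hW hx
      have hBl := (hl.along hW hBW).mdifferentiableAt hW hx
      have h1 : bracket 𝒥 k l =ᶠ[nhds x]
          fun y => along A k y * along B l y - along B k y * along A l y := by
        filter_upwards [hW.mem_nhds hx] with y hy using hbr k l y (hWV hy)
      rw [along_congr X h1, along_sub X (mdifferentiableAt_mul hAk hBl)
        (mdifferentiableAt_mul hBk hAl), along_mul X hAk hBl,
        along_mul X hBk hAl]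
    rw [hbr _ _ x (hWV hx), hbr _ _ x (hWV hx), hbr _ _ x (hWV hx),
      hd A hAW g h hg hh, hd B hBW g h hg hh, hd A hAW h f hh hf, hd B hBW h f hh hf,
      hd A hAW f g hf hg, hd B hBW f g hf hg]
    have hf' := hcomm W hWV hW f hf x hx
    have hg' := hcomm W hWV hW g hg x hx
    have hh' := hcomm W hWV hW h hh x hx
    rw [sub_eq_iff_eq_add] at hf' hg' hh'
    rw [hf', hg', hh']
    ring

/-- The field `p e₃ - q e₂`; the bivector field of `p e₂ + q e₃` is its exterior product
with `e₁`. In comments the frame is `(e₁, e₂, e₃)`, written `e 0`, `e 1`, `e 2` in formulas. -/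
def transverseField (e : Fin 3 → ∀ x : M, TangentSpace (𝓡 3) x) (p q : M → ℝ) (x : M) :
    TangentSpace (𝓡 3) x := p x • e 2 x - q x • e 1 x

lemma along_transverseField (e : Fin 3 → ∀ x : M, TangentSpace (𝓡 3) x) (p q f : M → ℝ) (x : M) :
    along (transverseField e p q) f x = p x * along (e 2) f x - q x * along (e 1) f x := by
  simp only [along, transverseField, map_sub, map_smul, smul_eq_mul]

lemma smoothFieldOn_transverseField [IsManifold (𝓡 3) ∞ M]
    {e : Fin 3 → ∀ x : M, TangentSpace (𝓡 3) x} {p q : M → ℝ} {V : Set M}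
    (he : ∀ i, SmoothFieldOn (e i) V) (hp : SmoothOn p V) (hq : SmoothOn q V) :
    SmoothFieldOn (transverseField e p q) V :=
  (ContMDiffOn.smul_section hp (he 2)).sub_section (ContMDiffOn.smul_section hq (he 1))

lemma poissonVector_eq (μ α : M → ℝ) (x : M) :
    poissonVector e μ α x = α x • e 1 x + (α x * μ x) • e 2 x := by
  rw [poissonVector, smul_add, smul_smul]

end Poisson

section Transport

variable {M : Type*} [TopologicalSpace M] [ChartedSpace (EuclideanSpace ℝ (Fin 3)) M]
  [Bundle.RiemannianBundle (fun x : M => TangentSpace (𝓡 3) x)]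
  {e : Fin 3 → ∀ x : M, TangentSpace (𝓡 3) x}

lemma inner_sharp {x : M} (a : Cotangent x) (T : TangentSpace (𝓡 3) x) :
    inner ℝ T (sharp x a) = a T := by
  rw [real_inner_comm]
  exact InnerProductSpace.toDual_symm_apply

/-- The pair `(p, q)` satisfies the linear equations expressing that
`[e₁, p e₃ - q e₂] = r (p e₃ - q e₂)` modulo `e₁`. -/
structure IsTransportedOn (e : Fin 3 → ∀ x : M, TangentSpace (𝓡 3) x) (r p q : M → ℝ)
    (V : Set M) : Prop where
  smooth_fst : SmoothOn p V
  smooth_snd : SmoothOn q V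
  eq_fst : ∀ x ∈ V, along (e 0) p x =
    r x * p x + p x * structFun e 2 0 2 x + q x * structFun e 0 1 2 x
  eq_snd : ∀ x ∈ V, along (e 0) q x =
    r x * q x - p x * structFun e 2 0 1 x - q x * structFun e 0 1 1 x

lemma IsTransportedOn.add {r p q p' q' : M → ℝ} {V : Set M} (hV : IsOpen V)
    (h : IsTransportedOn e r p q V) (h' : IsTransportedOn e r p' q' V) :
    IsTransportedOn e r (fun x => p x + p' x) (fun x => q x + q' x) V where
  smooth_fst := h.smooth_fst.add h'.smooth_fst
  smooth_snd := h.smooth_snd.add h'.smooth_snd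
  eq_fst x hx := by
    rw [along_add _ (h.smooth_fst.mdifferentiableAt hV hx) (h'.smooth_fst.mdifferentiableAt hV hx),
      h.eq_fst x hx, h'.eq_fst x hx]
    ring
  eq_snd x hx := by
    rw [along_add _ (h.smooth_snd.mdifferentiableAt hV hx) (h'.smooth_snd.mdifferentiableAt hV hx),
      h.eq_snd x hx, h'.eq_snd x hx]
    ring

/-- Scaling by `g` shifts the rate by the logarithmic derivative of `g`. -/
lemma IsTransportedOn.mul {p q g : M → ℝ} {V : Set M} (hV : IsOpen V)
    (h : IsTransportedOn e (fun _ => 0) p q V) (hg : SmoothOn g V) (hg0 : ∀ x ∈ V, g x ≠ 0) :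
    IsTransportedOn e (fun x => along (e 0) g x / g x) (fun x => g x * p x) (fun x => g x * q x)
      V where
  smooth_fst := hg.mul h.smooth_fst
  smooth_snd := hg.mul h.smooth_snd
  eq_fst x hx := by
    have := hg0 x hx
    rw [along_mul _ (hg.mdifferentiableAt hV hx) (h.smooth_fst.mdifferentiableAt hV hx),
      h.eq_fst x hx]
    field_simp
    ring
  eq_snd x hx := by
    have := hg0 x hx
    rw [along_mul _ (hg.mdifferentiableAt hV hx) (h.smooth_snd.mdifferentiableAt hV hx),
      h.eq_snd x hx]
    field_simp
    ring

end Transport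

section Frame

variable {M : Type*} [TopologicalSpace M] [ChartedSpace (EuclideanSpace ℝ (Fin 3)) M]
  [IsManifold (𝓡 3) ∞ M] [Bundle.RiemannianBundle (fun x : M => TangentSpace (𝓡 3) x)]
  {o : ∀ x : M, Orientation ℝ (TangentSpace (𝓡 3) x) (Fin 3)}
  {v : ∀ x : M, TangentSpace (𝓡 3) x} {e : Fin 3 → ∀ x : M, TangentSpace (𝓡 3) x} {U : Set M}

/-- The orthonormal basis of a tangent space given by an adapted frame. -/
def IsAdaptedFrameOn.basis (he : IsAdaptedFrameOn o v e U) {x : M} (hx : x ∈ U) :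
    OrthonormalBasis (Fin 3) ℝ (TangentSpace (𝓡 3) x) :=
  OrthonormalBasis.mk (he.orthonormal x hx) (by
    rw [(he.orthonormal x hx).linearIndependent.span_eq_top_of_card_eq_finrank'
      (by rw [Fintype.card_fin, (tangentSpace_finrank x).out])])

lemma IsAdaptedFrameOn.basis_apply (he : IsAdaptedFrameOn o v e U) {x : M} (hx : x ∈ U)
    (i : Fin 3) : he.basis hx i = e i x := by
  simp [IsAdaptedFrameOn.basis]

lemma IsAdaptedFrameOn.eq_sum (he : IsAdaptedFrameOn o v e U) {x : M} (hx : x ∈ U)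
    (T : TangentSpace (𝓡 3) x) : T = inner ℝ (e 0 x) T • e 0 x + inner ℝ (e 1 x) T • e 1 x +
      inner ℝ (e 2 x) T • e 2 x := by
  have h := ((he.basis hx).sum_repr T).symm
  simp only [Fin.sum_univ_three, OrthonormalBasis.repr_apply_apply, he.basis_apply hx] at h
  exact h

lemma IsAdaptedFrameOn.volumeForm_eq (he : IsAdaptedFrameOn o v e U) {x : M} (hx : x ∈ U) :
    (o x).volumeForm = (he.basis hx).toBasis.det := by
  refine (o x).volumeForm_robust _ ?_
  by_contra h
  have h1 := (o x).volumeForm_robust_neg _ h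
  have h2 := he.positive x hx
  have h3 : (fun i => e i x) = (he.basis hx).toBasis := by
    funext i
    simp [he.basis_apply hx]
  rw [h1, h3, AlternatingMap.neg_apply, Module.Basis.det_self] at h2
  linarith

/-- The bivector field of a vector field orthogonal to `e₁` is an exterior product with `e₁`. -/
lemma IsAdaptedFrameOn.toBivector_apply (he : IsAdaptedFrameOn o v e U) {x : M} (hx : x ∈ U)
    {J : ∀ x : M, TangentSpace (𝓡 3) x} {p q : M → ℝ} (hJ : J x = p x • e 1 x + q x • e 2 x)
    (a b : Cotangent x) :
    toBivector o J x ![a, b] = a (transverseField e p q x) * b (e 0 x) -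
      a (e 0 x) * b (transverseField e p q x) := by
  have h1 : toBivector o J x ![a, b] = (o x).volumeForm ![J x, sharp x a, sharp x b] := by
    show (o x).volumeForm (Matrix.vecCons (J x) fun i => sharp x (![a, b] i)) = _
    congr 1
    funext i
    fin_cases i <;> rfl
  have horth := orthonormal_iff_ite.1 (he.orthonormal x hx)
  have hJ0 : inner ℝ (e 0 x) (J x) = 0 := by
    rw [hJ, inner_add_right, inner_smul_right, inner_smul_right, horth 0 1, horth 0 2]
    simp
  have hJ1 : inner ℝ (e 1 x) (J x) = p x := by
    rw [hJ, inner_add_right, inner_smul_right, inner_smul_right, horth 1 1, horth 1 2]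
    simp
  have hJ2 : inner ℝ (e 2 x) (J x) = q x := by
    rw [hJ, inner_add_right, inner_smul_right, inner_smul_right, horth 2 1, horth 2 2]
    simp
  rw [h1, he.volumeForm_eq hx, Module.Basis.det_apply, Matrix.det_fin_three]
  simp only [Module.Basis.toMatrix_apply, OrthonormalBasis.coe_toBasis_repr_apply,
    OrthonormalBasis.repr_apply_apply, he.basis_apply hx, Matrix.cons_val_zero,
    Matrix.cons_val_one, Matrix.cons_val, inner_sharp, hJ0, hJ1, hJ2, transverseField, map_sub,
    map_smul, smul_eq_mul]
  ring

lemma IsAdaptedFrameOn.along_commutator (he : IsAdaptedFrameOn o v e U) {W : Set M} (hW : IsOpen W)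
    (hWU : W ⊆ U) {f : M → ℝ} (hf : SmoothOn f W) (i j : Fin 3) {x : M} (hx : x ∈ W) :
    along (e i) (along (e j) f) x - along (e j) (along (e i) f) x =
      structFun e i j 0 x * along (e 0) f x + structFun e i j 1 x * along (e 1) f x +
        structFun e i j 2 x * along (e 2) f x := by
  rw [← along_mlieBracket hW ((he.smooth i).mono hWU) ((he.smooth j).mono hWU) hf hx]
  conv_lhs => rw [along, he.eq_sum (hWU hx) (VectorField.mlieBracket (𝓡 3) (e i) (e j) x)]
  simp only [map_add, map_smul, smul_eq_mul, structFun, along, real_inner_comm]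

/-- The equations of `IsTransportedOn` express that `[e₁, p e₃ - q e₂]` is a combination of
`p e₃ - q e₂` and `e₁`. -/
lemma IsTransportedOn.commutator {r p q : M → ℝ} {V : Set M} (hV : IsOpen V)
    (h : IsTransportedOn e r p q V) (he : IsAdaptedFrameOn o v e U) (hVU : V ⊆ U)
    {W : Set M} (hWV : W ⊆ V) (hW : IsOpen W) {f : M → ℝ} (hf : SmoothOn f W) {x : M}
    (hx : x ∈ W) :
    along (e 0) (along (transverseField e p q) f) x -
        along (transverseField e p q) (along (e 0) f) x =
      r x * along (transverseField e p q) f x +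
        (-(p x * structFun e 2 0 0 x) - q x * structFun e 0 1 0 x) * along (e 0) f x := by
  have hes : ∀ i, SmoothFieldOn (e i) W := fun i => (he.smooth i).mono (hWV.trans hVU)
  have hp := h.smooth_fst.mdifferentiableAt hV (hWV hx)
  have hq := h.smooth_snd.mdifferentiableAt hV (hWV hx)
  have h1 := (hf.along hW (hes 1)).mdifferentiableAt hW hx
  have h2 := (hf.along hW (hes 2)).mdifferentiableAt hW hx
  have h3 : along (transverseField e p q) f =
      fun y => p y * along (e 2) f y - q y * along (e 1) f y :=
    funext fun y => along_transverseField e p q f y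
  rw [h3, along_transverseField, along_sub _ (mdifferentiableAt_mul hp h2)
    (mdifferentiableAt_mul hq h1), along_mul _ hp h2,
    along_mul _ hq h1, h.eq_fst x (hWV hx), h.eq_snd x (hWV hx)]
  have h4 := he.along_commutator hW (hWV.trans hVU) hf 2 0 hx
  have h5 := he.along_commutator hW (hWV.trans hVU) hf 0 1 hx
  linear_combination -p x * h4 - q x * h5

lemma IsTransportedOn.isPoissonOn {r p q : M → ℝ} {V : Set M} (hV : IsOpen V)
    (h : IsTransportedOn e r p q V) (he : IsAdaptedFrameOn o v e U) (hVU : V ⊆ U)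
    {𝒥 : BivectorField M} (h𝒥 : ∀ x ∈ V, ∀ a b : Cotangent x, 𝒥 x ![a, b] =
      a (transverseField e p q x) * b (e 0 x) - a (e 0 x) * b (transverseField e p q x)) :
    IsPoissonOn 𝒥 V :=
  isPoissonOn_of_commutator
    (smoothFieldOn_transverseField (fun i => (he.smooth i).mono hVU) h.smooth_fst h.smooth_snd)
    ((he.smooth 0).mono hVU) h𝒥
    fun _ hWV hW _ hf _ hx => h.commutator hV he hVU hWV hW hf hx

end Frame

/-! ### From solutions of the equations to bi-Hamiltonian structures -/

section Norm

variable {M : Type*} [TopologicalSpace M] [ChartedSpace (EuclideanSpace ℝ (Fin 3)) M]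
  [IsManifold (𝓡 3) ∞ M] [Bundle.RiemannianBundle (fun x : M => TangentSpace (𝓡 3) x)]
  [IsContMDiffRiemannianBundle (𝓡 3) ∞ (EuclideanSpace ℝ (Fin 3))
    (fun x : M => TangentSpace (𝓡 3) x)]

lemma smoothOn_inner {X Y : ∀ x : M, TangentSpace (𝓡 3) x} {U : Set M}
    (hX : SmoothFieldOn X U) (hY : SmoothFieldOn Y U) :
    SmoothOn (fun x => inner ℝ (X x) (Y x)) U :=
  ContMDiffOn.inner_bundle hX hY

lemma smoothOn_norm {X : ∀ x : M, TangentSpace (𝓡 3) x} {U : Set M}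
    (hX : SmoothFieldOn X U) (h0 : ∀ x ∈ U, X x ≠ 0) : SmoothOn (fun x => ‖X x‖) U := by
  have h : SmoothOn (fun x => √(inner ℝ (X x) (X x))) U := fun x hx =>
    (Real.contDiffAt_sqrt (inner_self_ne_zero.2 (h0 x hx))).contMDiffAt.comp_contMDiffWithinAt x
      (smoothOn_inner hX hX x hx)
  exact h.congr fun x _ => norm_eq_sqrt_real_inner (X x)

end Norm

section Solutions

variable {M : Type*} [TopologicalSpace M] [ChartedSpace (EuclideanSpace ℝ (Fin 3)) M]
  [Bundle.RiemannianBundle (fun x : M => TangentSpace (𝓡 3) x)]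
  {o : ∀ x : M, Orientation ℝ (TangentSpace (𝓡 3) x) (Fin 3)}
  {v : ∀ x : M, TangentSpace (𝓡 3) x} {e : Fin 3 → ∀ x : M, TangentSpace (𝓡 3) x} {U V : Set M}

/-- The Riccati and transport equations are linear in `α / ‖v‖` and `μ α / ‖v‖`. -/
lemma isTransportedOn_of_riccatiOn (hV : IsOpen V) (hv0 : ∀ x, v x ≠ 0)
    (hN : SmoothOn (fun x => ‖v x‖) V) {μ α : M → ℝ} (hμ : SmoothOn μ V) (hα : SmoothOn α V)
    (hα0 : ∀ x ∈ V, α x ≠ 0) (hR : RiccatiOn e μ V) (hT : TransportOn v e μ α V) :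
    IsTransportedOn e (fun _ => 0) (fun x => α x / ‖v x‖) (fun x => α x / ‖v x‖ * μ x) V := by
  have hu : SmoothOn (fun x => α x / ‖v x‖) V := hα.div hN fun x _ => norm_ne_zero_iff.2 (hv0 x)
  have h1 : ∀ x ∈ V, along (e 0) (fun x => α x / ‖v x‖) x =
      α x / ‖v x‖ * (structFun e 2 0 2 x + μ x * structFun e 0 1 2 x) := by
    intro x hx
    have h0 : α x / ‖v x‖ ≠ 0 := div_ne_zero (hα0 x hx) (norm_ne_zero_iff.2 (hv0 x))
    have h2 := hT x hx
    rw [along_log _ (hu.mdifferentiableAt hV hx) h0, div_eq_iff h0] at h2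
    rw [h2, mul_comm]
  refine ⟨hu, hu.mul hμ, fun x hx => ?_, fun x hx => ?_⟩
  · rw [h1 x hx]
    ring
  · rw [along_mul _ (hu.mdifferentiableAt hV hx) (hμ.mdifferentiableAt hV hx), h1 x hx, hR x hx]
    ring

/-- For two solutions the rate in the linear equations for `(α, α μ)` is the same, which is the
reason for their compatibility. -/
lemma isTransportedOn_of_riccatiOn' (hV : IsOpen V) (hv0 : ∀ x, v x ≠ 0)
    (hN : SmoothOn (fun x => ‖v x‖) V) {μ α : M → ℝ} (hμ : SmoothOn μ V) (hα : SmoothOn α V)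
    (hα0 : ∀ x ∈ V, α x ≠ 0) (hR : RiccatiOn e μ V) (hT : TransportOn v e μ α V) :
    IsTransportedOn e (fun x => along (e 0) (fun y => ‖v y‖) x / ‖v x‖) α
      (fun x => α x * μ x) V := by
  have h := (isTransportedOn_of_riccatiOn hV hv0 hN hμ hα hα0 hR hT).mul hV hN
    fun x _ => norm_ne_zero_iff.2 (hv0 x)
  have h1 : (fun x => ‖v x‖ * (α x / ‖v x‖)) = α :=
    funext fun x => mul_div_cancel₀ _ (norm_ne_zero_iff.2 (hv0 x))
  have h2 : (fun x => ‖v x‖ * (α x / ‖v x‖ * μ x)) = fun x => α x * μ x := funext fun x => by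
    rw [← mul_assoc, mul_div_cancel₀ _ (norm_ne_zero_iff.2 (hv0 x))]
  rwa [h1, h2] at h

variable [IsManifold (𝓡 3) ∞ M]

lemma IsAdaptedFrameOn.toBivector_poissonVector_apply (he : IsAdaptedFrameOn o v e U) {x : M}
    (hx : x ∈ U) (μ α : M → ℝ) (a b : Cotangent x) :
    toBivector o (poissonVector e μ α) x ![a, b] =
      a (transverseField e α (fun y => α y * μ y) x) * b (e 0 x) -
        a (e 0 x) * b (transverseField e α (fun y => α y * μ y) x) :=
  he.toBivector_apply hx (poissonVector_eq μ α x) a b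

lemma IsAdaptedFrameOn.isHamiltonianOn (he : IsAdaptedFrameOn o v e U) (hv0 : ∀ x, v x ≠ 0)
    (hVU : V ⊆ U) {μ α H : M → ℝ} (hH : SmoothOn H V)
    (h0 : ∀ x ∈ V, along (e 0) H x = 0)
    (h1 : ∀ x ∈ V, along (transverseField e α (fun y => α y * μ y)) H x = ‖v x‖) :
    IsHamiltonianOn v (toBivector o (poissonVector e μ α)) H V := by
  refine ⟨hH, fun x hx b => ?_⟩
  have h0' : diff H x (e 0 x) = 0 := h0 x hx
  have h1' : diff H x (transverseField e α (fun y => α y * μ y) x) = ‖v x‖ := h1 x hx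
  rw [he.toBivector_poissonVector_apply (hVU hx), h0', h1', he.first x (hVU hx), map_smul,
    smul_eq_mul, mul_inv_cancel_left₀ (norm_ne_zero_iff.2 (hv0 x)), zero_mul, sub_zero]

lemma IsAdaptedFrameOn.linearIndependent_toBivector (he : IsAdaptedFrameOn o v e U)
    {x : M} (hx : x ∈ U) {μ₁ μ₂ α₁ α₂ : M → ℝ} (hμ : μ₁ x ≠ μ₂ x) (hα₁ : α₁ x ≠ 0)
    (hα₂ : α₂ x ≠ 0) :
    LinearIndependent ℝ ![toBivector o (poissonVector e μ₁ α₁) x,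
      toBivector o (poissonVector e μ₂ α₂) x] := by
  rw [LinearIndependent.pair_iff]
  intro s t hst
  have horth := orthonormal_iff_ite.1 (he.orthonormal x hx)
  have hval : ∀ i, i ≠ 0 → ∀ μ α : M → ℝ, toBivector o (poissonVector e μ α) x
      ![innerSL ℝ (e i x), innerSL ℝ (e 0 x)] =
        inner ℝ (e i x) (transverseField e α (fun y => α y * μ y) x) := by
    intro i hi μ α
    rw [he.toBivector_poissonVector_apply hx, innerSL_apply_apply, innerSL_apply_apply,
      innerSL_apply_apply, innerSL_apply_apply, horth 0 0, horth i 0, if_pos rfl, if_neg hi,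
      mul_one, zero_mul, sub_zero]
  have h1 := congrArg (fun 𝒥 => 𝒥 ![innerSL ℝ (e 2 x), innerSL ℝ (e 0 x)]) hst
  have h2 := congrArg (fun 𝒥 => 𝒥 ![innerSL ℝ (e 1 x), innerSL ℝ (e 0 x)]) hst
  simp only [AlternatingMap.add_apply, AlternatingMap.smul_apply, AlternatingMap.zero_apply,
    hval 2 (by decide), hval 1 (by decide), transverseField, inner_sub_right, inner_smul_right,
    horth 2 2, horth 2 1, horth 1 2, horth 1 1, if_true, smul_eq_mul,
    if_neg (show ¬(2 : Fin 3) = 1 by decide), if_neg (show ¬(1 : Fin 3) = 2 by decide)] at h1 h2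
  have h3 : s * α₁ x * (μ₁ x - μ₂ x) = 0 := by linear_combination -h2 - μ₂ x * h1
  have hs : s = 0 := by simpa [hα₁, sub_eq_zero, hμ] using h3
  refine ⟨hs, ?_⟩
  rw [hs] at h1
  simpa [hα₂] using h1

lemma IsAdaptedFrameOn.isCompatiblePairOn (he : IsAdaptedFrameOn o v e U)
    (hv0 : ∀ x, v x ≠ 0) (hN : SmoothOn (fun x => ‖v x‖) V) (hV : IsOpen V) (hVU : V ⊆ U)
    {μ₁ μ₂ α₁ α₂ : M → ℝ} (h : IsSolutionOn v e μ₁ μ₂ α₁ α₂ V) :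
    IsCompatiblePairOn (toBivector o (poissonVector e μ₁ α₁))
      (toBivector o (poissonVector e μ₂ α₂)) V := by
  have h₁ := isTransportedOn_of_riccatiOn' hV hv0 hN h.smooth_μ₁ h.smooth_α₁ h.α₁_ne h.riccati₁
    h.transport₁
  have h₂ := isTransportedOn_of_riccatiOn' hV hv0 hN h.smooth_μ₂ h.smooth_α₂ h.α₂_ne h.riccati₂
    h.transport₂
  refine ⟨h₁.isPoissonOn hV he hVU fun x hx => he.toBivector_poissonVector_apply (hVU hx) _ _,
    h₂.isPoissonOn hV he hVU fun x hx => he.toBivector_poissonVector_apply (hVU hx) _ _,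
    fun x hx => he.linearIndependent_toBivector (hVU hx) (h.μ_ne x hx) (h.α₁_ne x hx)
      (h.α₂_ne x hx), (h₁.add hV h₂).isPoissonOn hV he hVU fun x hx a b => ?_⟩
  rw [AlternatingMap.add_apply, he.toBivector_poissonVector_apply (hVU hx),
    he.toBivector_poissonVector_apply (hVU hx)]
  simp only [transverseField, map_sub, map_smul, smul_eq_mul]
  ring

/-- Modulo `e₁`, the transported field `p e₃ - q e₂` is invariant along `e₁`, so that it has a
local time function which is constant along `e₁`. -/
theorem IsTransportedOn.exists_function (hV : IsOpen V) {p q : M → ℝ}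
    (h : IsTransportedOn e (fun _ => 0) p q V) (he : IsAdaptedFrameOn o v e U) (hVU : V ⊆ U)
    {z : M} (hz : z ∈ V) (hpz : p z ≠ 0) :
    ∃ W ⊆ V, IsOpen W ∧ z ∈ W ∧ ∃ H : M → ℝ, SmoothOn H W ∧
      ∀ x ∈ W, along (e 0) H x = 0 ∧ along (transverseField e p q) H x = 1 := by
  have hzU := hVU hz
  have hes : ∀ i, SmoothFieldOn (e i) V := fun i => (he.smooth i).mono hVU
  have he0 : e 0 z ≠ 0 := (he.orthonormal z hzU).ne_zero 0
  obtain ⟨Φ, w, hzΦ, hΦV, hw, hΦ, hΦs, hΦd⟩ := exists_flowBox_manifold hV (hes 0) hz he0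
  have hΦdiff : ∀ x ∈ Φ.source,
      MDifferentiableAt (𝓡 3) 𝓘(ℝ, EuclideanSpace ℝ (Fin 3)) Φ x := fun x hx =>
    (hΦ.contMDiffAt (Φ.open_source.mem_nhds hx)).mdifferentiableAt (by simp)
  set Y := transverseField e p q with hY
  have hYs : SmoothFieldOn Y V := smoothFieldOn_transverseField hes h.smooth_fst h.smooth_snd
  let Yh : M → EuclideanSpace ℝ (Fin 3) := fun x => mvfderiv (𝓡 3) Φ x (Y x)
  have hYh : ContMDiffOn (𝓡 3) 𝓘(ℝ, EuclideanSpace ℝ (Fin 3)) ∞ Yh Φ.source :=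
    contMDiffOn_mvfderiv_apply Φ.open_source (hYs.mono hΦV) hΦ
  have hZ : ContDiffOn ℝ ∞ (Yh ∘ Φ.symm) Φ.target :=
    contMDiffOn_iff_contDiffOn.1 (hYh.comp hΦs fun y hy => Φ.map_target hy)
  have hZΦ : ∀ x ∈ Φ.source, (Yh ∘ Φ.symm) (Φ x) = Yh x := fun x hx => by
    rw [Function.comp, Φ.left_inv hx]
  have hspan : (Yh ∘ Φ.symm) (Φ z) ∉ Submodule.span ℝ {w} := by
    rw [hZΦ z hzΦ]
    intro hmem
    obtain ⟨c, hc⟩ := Submodule.mem_span_singleton.1 hmem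
    have h1 : c • e 0 z = Y z := by
      refine mvfderiv_injective_of_openPartialHomeomorph hΦ hΦs hzΦ ?_
      rw [map_smul, hΦd z hzΦ]
      exact hc
    have horth := orthonormal_iff_ite.1 (he.orthonormal z hzU)
    have h2 := congrArg (fun T => inner ℝ (e 2 z) T) h1
    simp only [hY, transverseField, inner_sub_right, inner_smul_right, horth 2 0, horth 2 2,
      horth 2 1, if_true, if_neg (show ¬(2 : Fin 3) = 0 by decide),
      if_neg (show ¬(2 : Fin 3) = 1 by decide), mul_zero, mul_one, sub_zero] at h2
    exact hpz h2.symm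
  obtain ⟨H, T, hT, hzT, hTΦ, hH, hHd⟩ := exists_function_deriv_zero_one Φ.open_target hZ
    (Φ.map_source hzΦ) hw hspan (by
      intro ℓ hℓ y hy
      have hx := Φ.map_target hy
      set x := Φ.symm y with hxy
      have hyx : Φ x = y := Φ.right_inv hy
      have hk : SmoothOn (fun x => ℓ (Φ x)) Φ.source :=
        ℓ.contDiff.contMDiff.comp_contMDiffOn hΦ
      have halong : ∀ (X : ∀ x : M, TangentSpace (𝓡 3) x), ∀ x ∈ Φ.source,
          along X (fun x => ℓ (Φ x)) x = ℓ (mvfderiv (𝓡 3) Φ x (X x)) := by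
        intro X x hx
        rw [along_comp X ℓ.differentiableAt (hΦdiff x hx), ℓ.fderiv]
      have h0 : along (e 0) (fun x => ℓ (Φ x)) =ᶠ[nhds x] fun _ => 0 := by
        filter_upwards [Φ.open_source.mem_nhds hx] with t ht
        rw [halong (e 0) t ht, hΦd t ht, hℓ]
      have h1 : along Y (fun x => ℓ (Φ x)) =ᶠ[nhds x] fun t => ℓ ((Yh ∘ Φ.symm) (Φ t)) := by
        filter_upwards [Φ.open_source.mem_nhds hx] with t ht
        rw [halong Y t ht, hZΦ t ht]
      have h2 := h.commutator hV he hVU hΦV Φ.open_source hk hx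
      have h3 : along Y (fun _ : M => (0 : ℝ)) x = 0 := by
        simp [along, diff, mvfderiv_const]
      rw [along_congr _ h1, along_congr _ h0, h3, h0.eq_of_nhds, zero_mul, mul_zero, add_zero,
        sub_zero] at h2
      have h4 : DifferentiableAt ℝ (fun z => ℓ ((Yh ∘ Φ.symm) z)) (Φ x) := by
        rw [hyx]
        exact ℓ.differentiableAt.comp y
          ((hZ.contDiffAt (Φ.open_target.mem_nhds hy)).differentiableAt (by simp))
      have h5 := along_comp (e 0) h4 (hΦdiff x hx)
      rw [hΦd x hx, hyx] at h5
      exact h5.symm.trans h2)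
  refine ⟨Φ.source ∩ Φ ⁻¹' T, fun x hx => hΦV hx.1,
    hΦ.continuousOn.isOpen_inter_preimage Φ.open_source hT, ⟨hzΦ, hzT⟩, fun x => H (Φ x), ?_, ?_⟩
  · exact (contMDiffOn_iff_contDiffOn.2 hH).comp (hΦ.mono Set.inter_subset_left) fun x hx => hx.2
  · intro x hx
    have hHx : DifferentiableAt ℝ H (Φ x) :=
      (hH.contDiffAt (hT.mem_nhds hx.2)).differentiableAt (by simp)
    obtain ⟨h1, h2⟩ := hHd (Φ x) hx.2
    rw [along_comp _ hHx (hΦdiff x hx.1), along_comp _ hHx (hΦdiff x hx.1), hΦd x hx.1]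
    rw [hZΦ x hx.1] at h2
    exact ⟨h1, h2⟩

lemma IsAdaptedFrameOn.exists_isHamiltonianOn (he : IsAdaptedFrameOn o v e U)
    (hv0 : ∀ x, v x ≠ 0) (hN : SmoothOn (fun x => ‖v x‖) V) (hV : IsOpen V) (hVU : V ⊆ U)
    {μ α : M → ℝ} (hμ : SmoothOn μ V) (hα : SmoothOn α V) (hα0 : ∀ x ∈ V, α x ≠ 0)
    (hR : RiccatiOn e μ V) (hT : TransportOn v e μ α V) {z : M} (hz : z ∈ V) :
    ∃ W ⊆ V, IsOpen W ∧ z ∈ W ∧ ∃ H : M → ℝ,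
      IsHamiltonianOn v (toBivector o (poissonVector e μ α)) H W := by
  obtain ⟨W, hWV, hW, hzW, H, hH, hd⟩ :=
    (isTransportedOn_of_riccatiOn hV hv0 hN hμ hα hα0 hR hT).exists_function hV he hVU hz
      (div_ne_zero (hα0 z hz) (norm_ne_zero_iff.2 (hv0 z)))
  refine ⟨W, hWV, hW, hzW, H, he.isHamiltonianOn hv0 (hWV.trans hVU) hH
    (fun x hx => (hd x hx).1) fun x hx => ?_⟩
  have h1 := (hd x hx).2
  have h0 : ‖v x‖ ≠ 0 := norm_ne_zero_iff.2 (hv0 x)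
  rw [along_transverseField] at h1 ⊢
  field_simp at h1
  linear_combination h1

end Solutions

/-! ### Solutions from first integrals -/

lemma exists_clm_apply_eq {E : Type*} [NormedAddCommGroup E] [NormedSpace ℝ E]
    [FiniteDimensional ℝ E] {ι : Type*} [Fintype ι] [Nonempty ι] {a : ι → E}
    (ha : LinearIndependent ℝ a) (hc : Fintype.card ι = Module.finrank ℝ E) (c : ι → ℝ) :
    ∃ ℓ : E →L[ℝ] ℝ, ∀ i, ℓ (a i) = c i := by
  let b := basisOfLinearIndependentOfCardEqFinrank ha hc
  refine ⟨(b.constr ℝ c).toContinuousLinearMap, fun i => ?_⟩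
  have h := b.constr_basis ℝ c i
  rwa [coe_basisOfLinearIndependentOfCardEqFinrank] at h

section FirstIntegrals

variable {M : Type*} [TopologicalSpace M] [ChartedSpace (EuclideanSpace ℝ (Fin 3)) M]
  [IsManifold (𝓡 3) ∞ M] [Bundle.RiemannianBundle (fun x : M => TangentSpace (𝓡 3) x)]
  {o : ∀ x : M, Orientation ℝ (TangentSpace (𝓡 3) x) (Fin 3)}
  {v : ∀ x : M, TangentSpace (𝓡 3) x} {e : Fin 3 → ∀ x : M, TangentSpace (𝓡 3) x} {U V : Set M}

/-- Locally there are two first integrals of `e₁` with independent gradients, with derivatives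
`(1, 0)` and `(1, 1)` along `(e₂, e₃)` at a given point. -/
lemma IsAdaptedFrameOn.exists_firstIntegrals (he : IsAdaptedFrameOn o v e U) (hU : IsOpen U)
    {z : M} (hz : z ∈ U) :
    ∃ W ⊆ U, IsOpen W ∧ z ∈ W ∧ ∃ h₁ h₂ : M → ℝ, SmoothOn h₁ W ∧ SmoothOn h₂ W ∧
      (∀ x ∈ W, along (e 0) h₁ x = 0) ∧ (∀ x ∈ W, along (e 0) h₂ x = 0) ∧
      along (e 1) h₁ z = 1 ∧ along (e 2) h₁ z = 0 ∧
      along (e 1) h₂ z = 1 ∧ along (e 2) h₂ z = 1 := by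
  obtain ⟨Φ, w, hzΦ, hΦU, hw, hΦ, hΦs, hΦd⟩ :=
    exists_flowBox_manifold hU (he.smooth 0) hz ((he.orthonormal z hz).ne_zero 0)
  have hind : LinearIndependent ℝ fun i => mvfderiv (𝓡 3) Φ z (e i z) :=
    (he.orthonormal z hz).linearIndependent.map' (mvfderiv (𝓡 3) Φ z).toLinearMap
      (LinearMap.ker_eq_bot.2 (mvfderiv_injective_of_openPartialHomeomorph hΦ hΦs hzΦ))
  have hcard : Fintype.card (Fin 3) = Module.finrank ℝ (EuclideanSpace ℝ (Fin 3)) := by simp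
  obtain ⟨ℓ₁, h₁⟩ := exists_clm_apply_eq hind hcard ![0, 1, 0]
  obtain ⟨ℓ₂, h₂⟩ := exists_clm_apply_eq hind hcard ![0, 1, 1]
  have hs : ∀ ℓ : EuclideanSpace ℝ (Fin 3) →L[ℝ] ℝ, SmoothOn (fun x => ℓ (Φ x)) Φ.source :=
    fun ℓ => ℓ.contDiff.contMDiff.comp_contMDiffOn hΦ
  have halong : ∀ (ℓ : EuclideanSpace ℝ (Fin 3) →L[ℝ] ℝ) (i : Fin 3), ∀ x ∈ Φ.source,
      along (e i) (fun x => ℓ (Φ x)) x = ℓ (mvfderiv (𝓡 3) Φ x (e i x)) := by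
    intro ℓ i x hx
    rw [along_comp (e i) ℓ.differentiableAt ((hΦ.contMDiffAt
      (Φ.open_source.mem_nhds hx)).mdifferentiableAt (by simp)), ℓ.fderiv]
  refine ⟨Φ.source, hΦU, Φ.open_source, hzΦ, fun x => ℓ₁ (Φ x), fun x => ℓ₂ (Φ x), hs _, hs _,
    fun x hx => ?_, fun x hx => ?_, ?_, ?_, ?_, ?_⟩
  · rw [halong _ _ x hx, hΦd x hx, ← hΦd z hzΦ]
    exact h₁ 0
  · rw [halong _ _ x hx, hΦd x hx, ← hΦd z hzΦ]
    exact h₂ 0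
  · exact (halong _ _ z hzΦ).trans (h₁ 1)
  · exact (halong _ _ z hzΦ).trans (h₁ 2)
  · exact (halong _ _ z hzΦ).trans (h₂ 1)
  · exact (halong _ _ z hzΦ).trans (h₂ 2)

/-- The evolution along `e₁` of the transversal derivatives of a first integral. -/
lemma IsAdaptedFrameOn.along_along_firstIntegral (he : IsAdaptedFrameOn o v e U) (hV : IsOpen V)
    (hVU : V ⊆ U) {h : M → ℝ} (hh : SmoothOn h V) (h0 : ∀ x ∈ V, along (e 0) h x = 0) {x : M}
    (hx : x ∈ V) :
    along (e 0) (along (e 1) h) x =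
        structFun e 0 1 1 x * along (e 1) h x + structFun e 0 1 2 x * along (e 2) h x ∧
      along (e 0) (along (e 2) h) x =
        -structFun e 2 0 1 x * along (e 1) h x - structFun e 2 0 2 x * along (e 2) h x := by
  have h1 : ∀ X : (∀ x : M, TangentSpace (𝓡 3) x), along X (along (e 0) h) x = 0 := by
    intro X
    have h2 : along (e 0) h =ᶠ[nhds x] fun _ => 0 := by
      filter_upwards [hV.mem_nhds hx] with y hy using h0 y hy
    rw [along_congr X h2]
    simp [along, diff, mvfderiv_const]
  have h3 := he.along_commutator hV hVU hh 0 1 hx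
  have h4 := he.along_commutator hV hVU hh 2 0 hx
  rw [h1, h0 x hx] at h3 h4
  constructor
  · linear_combination h3
  · linear_combination -h4

/-- The slope `e₃ h / e₂ h` of the gradient of a first integral solves the Riccati equation. -/
lemma IsAdaptedFrameOn.riccatiOn_of_firstIntegral (he : IsAdaptedFrameOn o v e U) (hV : IsOpen V)
    (hVU : V ⊆ U) {h : M → ℝ} (hh : SmoothOn h V) (h0 : ∀ x ∈ V, along (e 0) h x = 0)
    (h1 : ∀ x ∈ V, along (e 1) h x ≠ 0) :
    RiccatiOn e (fun x => along (e 2) h x / along (e 1) h x) V := by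
  intro x hx
  have hs1 := hh.along hV ((he.smooth 1).mono hVU)
  have hs2 := hh.along hV ((he.smooth 2).mono hVU)
  have hμ := (hs2.div hs1 h1).mdifferentiableAt hV hx
  obtain ⟨h2, h3⟩ := he.along_along_firstIntegral hV hVU hh h0 hx
  have h4 : along (e 2) h =ᶠ[nhds x]
      fun y => along (e 2) h y / along (e 1) h y * along (e 1) h y := by
    filter_upwards [hV.mem_nhds hx] with y hy
    rw [div_mul_cancel₀ _ (h1 y hy)]
  rw [along_congr _ h4, along_mul _ hμ (hs1.mdifferentiableAt hV hx), h2] at h3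
  have h5 := h1 x hx
  refine mul_left_cancel₀ h5 ?_
  field_simp at h3 ⊢
  linear_combination h3

/-- The Jacobian `e₂ h₁ e₃ h₂ - e₃ h₁ e₂ h₂` of two first integrals on the planes orthogonal
to `e₁`. -/
def transverseJacobian (e : Fin 3 → ∀ x : M, TangentSpace (𝓡 3) x) (h₁ h₂ : M → ℝ) (x : M) : ℝ :=
  along (e 1) h₁ x * along (e 2) h₂ x - along (e 2) h₁ x * along (e 1) h₂ x

lemma IsAdaptedFrameOn.smoothOn_transverseJacobian (he : IsAdaptedFrameOn o v e U)
    (hV : IsOpen V) (hVU : V ⊆ U) {h₁ h₂ : M → ℝ} (hh₁ : SmoothOn h₁ V) (hh₂ : SmoothOn h₂ V) :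
    SmoothOn (transverseJacobian e h₁ h₂) V :=
  ((hh₁.along hV ((he.smooth 1).mono hVU)).mul (hh₂.along hV ((he.smooth 2).mono hVU))).sub
    ((hh₁.along hV ((he.smooth 2).mono hVU)).mul (hh₂.along hV ((he.smooth 1).mono hVU)))

/-- Liouville's formula for the Jacobian of two first integrals. -/
lemma IsAdaptedFrameOn.along_transverseJacobian (he : IsAdaptedFrameOn o v e U) (hV : IsOpen V)
    (hVU : V ⊆ U) {h₁ h₂ : M → ℝ} (hh₁ : SmoothOn h₁ V) (hh₂ : SmoothOn h₂ V)
    (h₁0 : ∀ x ∈ V, along (e 0) h₁ x = 0) (h₂0 : ∀ x ∈ V, along (e 0) h₂ x = 0) {x : M}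
    (hx : x ∈ V) :
    along (e 0) (transverseJacobian e h₁ h₂) x =
      (structFun e 0 1 1 x - structFun e 2 0 2 x) * transverseJacobian e h₁ h₂ x := by
  have a1 := (hh₁.along hV ((he.smooth 1).mono hVU)).mdifferentiableAt hV hx
  have a2 := (hh₁.along hV ((he.smooth 2).mono hVU)).mdifferentiableAt hV hx
  have b1 := (hh₂.along hV ((he.smooth 1).mono hVU)).mdifferentiableAt hV hx
  have b2 := (hh₂.along hV ((he.smooth 2).mono hVU)).mdifferentiableAt hV hx
  obtain ⟨h2, h3⟩ := he.along_along_firstIntegral hV hVU hh₁ h₁0 hx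
  obtain ⟨h4, h5⟩ := he.along_along_firstIntegral hV hVU hh₂ h₂0 hx
  have h6 : transverseJacobian e h₁ h₂ = fun y => along (e 1) h₁ y * along (e 2) h₂ y -
    along (e 2) h₁ y * along (e 1) h₂ y := rfl
  rw [h6, along_sub _ (mdifferentiableAt_mul a1 b2) (mdifferentiableAt_mul a2 b1),
    along_mul _ a1 b2, along_mul _ a2 b1, h2, h3, h4, h5]
  ring

/-- If `D` evolves along `e₁` as the Jacobian of two first integrals does, then
`α = s ‖v‖ e₂ h / D` solves the transport equation for a first integral `h`. -/
lemma IsAdaptedFrameOn.transportOn_of_firstIntegral (he : IsAdaptedFrameOn o v e U)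
    (hv0 : ∀ x, v x ≠ 0) (hV : IsOpen V) (hVU : V ⊆ U) {h D : M → ℝ} (hh : SmoothOn h V)
    (h0 : ∀ x ∈ V, along (e 0) h x = 0) (h1 : ∀ x ∈ V, along (e 1) h x ≠ 0)
    (hD : SmoothOn D V) (hD0 : ∀ x ∈ V, D x ≠ 0)
    (hDe : ∀ x ∈ V, along (e 0) D x = (structFun e 0 1 1 x - structFun e 2 0 2 x) * D x)
    {s : ℝ} (hs : s ≠ 0) :
    TransportOn v e (fun x => along (e 2) h x / along (e 1) h x)
      (fun x => s * along (e 1) h x / D x * ‖v x‖) V := by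
  intro x hx
  have hs1 := hh.along hV ((he.smooth 1).mono hVU)
  have hc : SmoothOn (fun _ : M => s) V := contMDiffOn_const
  have hu : SmoothOn (fun x => s * along (e 1) h x / D x) V := (hc.mul hs1).div hD hD0
  have h2 : (fun y => Real.log (s * along (e 1) h y / D y * ‖v y‖ / ‖v y‖)) =
      fun y => Real.log (s * along (e 1) h y / D y) := by
    funext y
    rw [mul_div_cancel_right₀ _ (norm_ne_zero_iff.2 (hv0 y))]
  have hux : s * along (e 1) h x / D x ≠ 0 := div_ne_zero (mul_ne_zero hs (h1 x hx)) (hD0 x hx)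
  rw [h2, along_log _ (hu.mdifferentiableAt hV hx) hux]
  have h3 : (fun y => s * along (e 1) h y) =ᶠ[nhds x]
      fun y => s * along (e 1) h y / D y * D y := by
    filter_upwards [hV.mem_nhds hx] with y hy
    rw [div_mul_cancel₀ _ (hD0 y hy)]
  have h4 := along_congr (e 0) h3
  have h5 : along (e 0) (fun _ : M => s) x = 0 := by simp [along, diff, mvfderiv_const]
  rw [along_mul _ (hc.mdifferentiableAt hV hx) (hs1.mdifferentiableAt hV hx), h5,
    along_mul _ (hu.mdifferentiableAt hV hx) (hD.mdifferentiableAt hV hx), hDe x hx,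
    (he.along_along_firstIntegral hV hVU hh h0 hx).1] at h4
  have h6 := h1 x hx
  have h7 := hD0 x hx
  rw [div_eq_iff hux]
  refine mul_left_cancel₀ h7 ?_
  field_simp at h4 ⊢
  linear_combination -h4

lemma IsAdaptedFrameOn.grad_eq (he : IsAdaptedFrameOn o v e U) {x : M} (hx : x ∈ U) (h : M → ℝ) :
    grad h x = along (e 0) h x • e 0 x + along (e 1) h x • e 1 x + along (e 2) h x • e 2 x := by
  have h1 := he.eq_sum hx (grad h x)
  simp only [grad, inner_sharp] at h1
  exact h1

/-- Two first integrals with independent gradients are Hamiltonians of `v` for the Poisson vector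
fields proportional to their gradients. -/
theorem IsAdaptedFrameOn.exists_solution (he : IsAdaptedFrameOn o v e U)
    (hv0 : ∀ x, v x ≠ 0) (hN : SmoothOn (fun x => ‖v x‖) U) (hU : IsOpen U) {z : M} (hz : z ∈ U) :
    ∃ V ⊆ U, IsOpen V ∧ z ∈ V ∧ ∃ μ₁ μ₂ α₁ α₂ H₁ H₂ : M → ℝ,
      IsSolutionOn v e μ₁ μ₂ α₁ α₂ V ∧
      IsCompatiblePairOn (toBivector o (poissonVector e μ₁ α₁))
        (toBivector o (poissonVector e μ₂ α₂)) V ∧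
      IsBiHamiltonianOn v (toBivector o (poissonVector e μ₁ α₁))
        (toBivector o (poissonVector e μ₂ α₂)) H₁ H₂ V ∧
      ∀ x ∈ V, poissonVector e μ₁ α₁ x = -phi v μ₁ μ₂ α₁ α₂ x • grad H₁ x ∧
        poissonVector e μ₂ α₂ x = phi v μ₁ μ₂ α₁ α₂ x • grad H₂ x := by
  obtain ⟨W, hWU, hW, hzW, h₁, h₂, hs₁, hs₂, h₁0, h₂0, h₁z, h₁z', h₂z, h₂z'⟩ :=
    he.exists_firstIntegrals hU hz
  have hd : ∀ h : M → ℝ, SmoothOn h W → SmoothOn (along (e 1) h) W := fun h hh =>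
    hh.along hW ((he.smooth 1).mono hWU)
  have hJ := he.smoothOn_transverseJacobian hW hWU hs₁ hs₂
  set D := transverseJacobian e h₁ h₂ with hDdef
  have hprod : SmoothOn (fun x => along (e 1) h₁ x * along (e 1) h₂ x * D x) W :=
    ((hd h₁ hs₁).mul (hd h₂ hs₂)).mul hJ
  let V : Set M := W ∩ (fun x => along (e 1) h₁ x * along (e 1) h₂ x * D x) ⁻¹' {0}ᶜ
  have hV : IsOpen V := hprod.continuousOn.isOpen_inter_preimage hW isOpen_compl_singleton
  have hzV : z ∈ V := by
    refine ⟨hzW, ?_⟩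
    simp [hDdef, transverseJacobian, h₁z, h₂z, h₁z', h₂z']
  have hVW : V ⊆ W := Set.inter_subset_left
  have hVU : V ⊆ U := hVW.trans hWU
  have hne : ∀ x ∈ V, along (e 1) h₁ x ≠ 0 ∧ along (e 1) h₂ x ≠ 0 ∧ D x ≠ 0 := by
    intro x hx
    have h3 : along (e 1) h₁ x * along (e 1) h₂ x * D x ≠ 0 := hx.2
    exact ⟨left_ne_zero_of_mul (left_ne_zero_of_mul h3),
      right_ne_zero_of_mul (left_ne_zero_of_mul h3), right_ne_zero_of_mul h3⟩
  have hN' := hN.mono hVU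
  have hv : ∀ x, ‖v x‖ ≠ 0 := fun x => norm_ne_zero_iff.2 (hv0 x)
  have hDe : ∀ x ∈ V, along (e 0) D x = (structFun e 0 1 1 x - structFun e 2 0 2 x) * D x :=
    fun x hx => he.along_transverseJacobian hW hWU hs₁ hs₂ h₁0 h₂0 (hVW hx)
  have hμs : ∀ h : M → ℝ, SmoothOn h W → (∀ x ∈ V, along (e 1) h x ≠ 0) →
      SmoothOn (fun x => along (e 2) h x / along (e 1) h x) V := fun h hh h3 =>
    ((hh.along hW ((he.smooth 2).mono hWU)).mono hVW).div ((hd h hh).mono hVW) h3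
  have hαs : ∀ (s : ℝ) (h : M → ℝ), SmoothOn h W →
      SmoothOn (fun x => s * along (e 1) h x / D x * ‖v x‖) V := fun s h hh =>
    SmoothOn.mul (SmoothOn.div (SmoothOn.mul contMDiffOn_const ((hd h hh).mono hVW))
      (hJ.mono hVW) fun x hx => (hne x hx).2.2) hN'
  have hsol : IsSolutionOn v e (fun x => along (e 2) h₁ x / along (e 1) h₁ x)
      (fun x => along (e 2) h₂ x / along (e 1) h₂ x)
      (fun x => 1 * along (e 1) h₁ x / D x * ‖v x‖)
      (fun x => -1 * along (e 1) h₂ x / D x * ‖v x‖) V :=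
    { smooth_μ₁ := hμs h₁ hs₁ fun x hx => (hne x hx).1
      smooth_μ₂ := hμs h₂ hs₂ fun x hx => (hne x hx).2.1
      smooth_α₁ := hαs 1 h₁ hs₁
      smooth_α₂ := hαs (-1) h₂ hs₂
      μ_ne := by
        intro x hx h3
        obtain ⟨h4, h5, h6⟩ := hne x hx
        rw [div_eq_div_iff h4 h5] at h3
        refine h6 ?_
        rw [hDdef, transverseJacobian]
        linear_combination -h3
      α₁_ne := fun x hx => mul_ne_zero
        (div_ne_zero (mul_ne_zero one_ne_zero (hne x hx).1) (hne x hx).2.2) (hv x)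
      α₂_ne := fun x hx => mul_ne_zero
        (div_ne_zero (mul_ne_zero (by norm_num) (hne x hx).2.1) (hne x hx).2.2) (hv x)
      riccati₁ := he.riccatiOn_of_firstIntegral hV hVU (hs₁.mono hVW)
        (fun x hx => h₁0 x (hVW hx)) fun x hx => (hne x hx).1
      riccati₂ := he.riccatiOn_of_firstIntegral hV hVU (hs₂.mono hVW)
        (fun x hx => h₂0 x (hVW hx)) fun x hx => (hne x hx).2.1
      transport₁ := he.transportOn_of_firstIntegral hv0 hV hVU (hs₁.mono hVW)
        (fun x hx => h₁0 x (hVW hx)) (fun x hx => (hne x hx).1) (hJ.mono hVW)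
        (fun x hx => (hne x hx).2.2) hDe one_ne_zero
      transport₂ := he.transportOn_of_firstIntegral hv0 hV hVU (hs₂.mono hVW)
        (fun x hx => h₂0 x (hVW hx)) (fun x hx => (hne x hx).2.1) (hJ.mono hVW)
        (fun x hx => (hne x hx).2.2) hDe (by norm_num) }
  have hcomp := he.isCompatiblePairOn hv0 hN' hV hVU hsol
  have hDx : ∀ x, D x = along (e 1) h₁ x * along (e 2) h₂ x -
    along (e 2) h₁ x * along (e 1) h₂ x := fun x => rfl
  refine ⟨V, hVU, hV, hzV, _, _, _, _, h₁, h₂, hsol, hcomp,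
    ⟨hcomp.poisson₁, hcomp.poisson₂, hcomp.independent, ?_, ?_⟩, fun x hx => ?_⟩
  · refine he.isHamiltonianOn hv0 hVU (hs₂.mono hVW) (fun x hx => h₂0 x (hVW hx)) fun x hx => ?_
    obtain ⟨h4, h5, h6⟩ := hne x hx
    rw [along_transverseField]
    field_simp
    rw [hDx x]
    ring
  · refine he.isHamiltonianOn hv0 hVU (hs₁.mono hVW) (fun x hx => h₁0 x (hVW hx)) fun x hx => ?_
    obtain ⟨h4, h5, h6⟩ := hne x hx
    rw [along_transverseField]
    field_simp
    rw [hDx x]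
    ring
  · obtain ⟨h4, h5, h6⟩ := hne x hx
    have h7 : phi v (fun x => along (e 2) h₁ x / along (e 1) h₁ x)
        (fun x => along (e 2) h₂ x / along (e 1) h₂ x)
        (fun x => 1 * along (e 1) h₁ x / D x * ‖v x‖)
        (fun x => -1 * along (e 1) h₂ x / D x * ‖v x‖) x = -‖v x‖ / D x := by
      have := hv x
      rw [phi]
      field_simp
      rw [hDx x]
      ring
    rw [h7, poissonVector_eq, poissonVector_eq, he.grad_eq (hVU hx), he.grad_eq (hVU hx),
      h₁0 x (hVW hx), h₂0 x (hVW hx), zero_smul, zero_add, zero_add, smul_add, smul_add,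
      smul_smul, smul_smul, smul_smul, smul_smul]
    constructor <;> congr 2 <;> field_simp

end FirstIntegrals

/-! ### Existence of adapted frames -/

section AdaptedFrames

variable {M : Type*} [TopologicalSpace M] [ChartedSpace (EuclideanSpace ℝ (Fin 3)) M]
  [IsManifold (𝓡 3) ∞ M] [Bundle.RiemannianBundle (fun x : M => TangentSpace (𝓡 3) x)]
  [IsContMDiffRiemannianBundle (𝓡 3) ∞ (EuclideanSpace ℝ (Fin 3))
    (fun x : M => TangentSpace (𝓡 3) x)]

lemma smoothFieldOn_normalize {X : ∀ x : M, TangentSpace (𝓡 3) x} {U : Set M}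
    (hX : SmoothFieldOn X U) (h0 : ∀ x ∈ U, X x ≠ 0) :
    SmoothFieldOn (fun x => ‖X x‖⁻¹ • X x) U :=
  ContMDiffOn.smul_section ((smoothOn_norm hX h0).inv fun x hx => norm_ne_zero_iff.2 (h0 x hx)) hX

lemma isOpen_inter_ne_zero {X : ∀ x : M, TangentSpace (𝓡 3) x} {U : Set M} (hU : IsOpen U)
    (hX : SmoothFieldOn X U) : IsOpen (U ∩ {x | X x ≠ 0}) := by
  have h : U ∩ {x | X x ≠ 0} = U ∩ (fun x => inner ℝ (X x) (X x)) ⁻¹' {0}ᶜ := by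
    ext x
    simp
  rw [h]
  exact (smoothOn_inner hX hX).continuousOn.isOpen_inter_preimage hU isOpen_compl_singleton

/-- A step of the Gram-Schmidt process for smooth fields. -/
lemma exists_unit_orthogonal {ι : Type*} [Fintype ι] {e : ι → ∀ x : M, TangentSpace (𝓡 3) x}
    {f : ∀ x : M, TangentSpace (𝓡 3) x} {U : Set M} (hU : IsOpen U)
    (he : ∀ i, SmoothFieldOn (e i) U) (hon : ∀ x ∈ U, Orthonormal ℝ fun i => e i x)
    (hf : SmoothFieldOn f U) {p : M} (hp : p ∈ U)
    (hfp : f p ∉ Submodule.span ℝ (Set.range fun i => e i p)) :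
    ∃ W ⊆ U, IsOpen W ∧ p ∈ W ∧ ∃ g : ∀ x : M, TangentSpace (𝓡 3) x, SmoothFieldOn g W ∧
      ∀ x ∈ W, ‖g x‖ = 1 ∧ ∀ i, inner ℝ (e i x) (g x) = 0 := by
  classical
  let S : ∀ x : M, TangentSpace (𝓡 3) x := fun x => ∑ i, inner ℝ (e i x) (f x) • e i x
  have hS : SmoothFieldOn S U :=
    ContMDiffOn.sum_section fun i _ => ContMDiffOn.smul_section (smoothOn_inner (he i) hf) (he i)
  let G : ∀ x : M, TangentSpace (𝓡 3) x := fun x => f x - S x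
  have hG : SmoothFieldOn G U := ContMDiffOn.sub_section hf hS
  have hGp : G p ≠ 0 := by
    intro h
    refine hfp ?_
    rw [sub_eq_zero.1 h]
    exact Submodule.sum_mem _ fun i _ => Submodule.smul_mem _ _ (Submodule.subset_span ⟨i, rfl⟩)
  refine ⟨U ∩ {x | G x ≠ 0}, Set.inter_subset_left, isOpen_inter_ne_zero hU hG, ⟨hp, hGp⟩,
    fun x => ‖G x‖⁻¹ • G x,
    smoothFieldOn_normalize (hG.mono Set.inter_subset_left) fun x hx => hx.2, fun x hx => ?_⟩
  have hGx : ‖G x‖ ≠ 0 := norm_ne_zero_iff.2 hx.2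
  refine ⟨by rw [norm_smul, norm_inv, norm_norm, inv_mul_cancel₀ hGx], fun i => ?_⟩
  rw [inner_smul_right, inner_sub_right, (hon x hx.1).inner_right_fintype, sub_self, mul_zero]

lemma exists_notMem_span {E : Type*} [NormedAddCommGroup E] [InnerProductSpace ℝ E]
    [Fact (Module.finrank ℝ E = 3)] [FiniteDimensional ℝ E] (o : Orientation ℝ E (Fin 3))
    {f : Fin 3 → E} (hf : o.volumeForm f ≠ 0) {ι : Type*} [Fintype ι] (hι : Fintype.card ι < 3)
    (a : ι → E) : ∃ i, f i ∉ Submodule.span ℝ (Set.range a) := by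
  by_contra! h
  have hdim : Module.finrank ℝ E = 3 := Fact.out
  have hli : LinearIndependent ℝ f := by
    by_contra hli
    exact hf (o.volumeForm.map_linearDependent f hli)
  have h1 := hli.span_eq_top_of_card_eq_finrank' (by rw [Fintype.card_fin, hdim])
  have h2 : Submodule.span ℝ (Set.range a) = ⊤ := by
    rw [eq_top_iff, ← h1, Submodule.span_le]
    rintro _ ⟨i, rfl⟩
    exact h i
  have h3 := finrank_range_le_card (R := ℝ) a
  rw [Set.finrank, h2, finrank_top, hdim] at h3
  omega

lemma volumeForm_eq_mul_det {E : Type*} [NormedAddCommGroup E] [InnerProductSpace ℝ E]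
    [Fact (Module.finrank ℝ E = 3)] [FiniteDimensional ℝ E] (o : Orientation ℝ E (Fin 3))
    {e : Fin 3 → E} (he : Orthonormal ℝ e) (f : Fin 3 → E) :
    o.volumeForm f =
      o.volumeForm e * Matrix.det (Matrix.of fun i j => inner ℝ (e i) (f j)) := by
  have hdim : Module.finrank ℝ E = 3 := Fact.out
  let b : OrthonormalBasis (Fin 3) ℝ E := OrthonormalBasis.mk he (by
    rw [he.linearIndependent.span_eq_top_of_card_eq_finrank' (by rw [Fintype.card_fin, hdim])])
  have hb : ⇑b.toBasis = e := by simp [b]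
  have h1 := congrArg (fun η => η f) (o.volumeForm.eq_smul_basis_det b.toBasis)
  simp only [hb, AlternatingMap.smul_apply, smul_eq_mul, Module.Basis.det_apply] at h1
  rw [h1]
  congr 2
  ext i j
  simp [Module.Basis.toMatrix_apply, OrthonormalBasis.repr_apply_apply, b]

lemma orthonormal_vec_three {E : Type*} [NormedAddCommGroup E] [InnerProductSpace ℝ E]
    {a b c : E} (ha : ‖a‖ = 1) (hb : ‖b‖ = 1) (hc : ‖c‖ = 1) (hab : inner ℝ a b = 0)
    (hac : inner ℝ a c = 0) (hbc : inner ℝ b c = 0) : Orthonormal ℝ ![a, b, c] := by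
  refine ⟨fun i => ?_, fun i j hij => ?_⟩
  · fin_cases i
    exacts [ha, hb, hc]
  · fin_cases i <;> fin_cases j
    exacts [absurd rfl hij, hab, hac, (real_inner_comm _ _).trans hab, absurd rfl hij, hbc,
      (real_inner_comm _ _).trans hac, (real_inner_comm _ _).trans hbc, absurd rfl hij]

/-- The orientation is detected by the sign of the matrix of inner products with a positive frame,
which is locally constant. -/
lemma exists_isAdaptedFrameOn_of_det_pos
    {o : ∀ x : M, Orientation ℝ (TangentSpace (𝓡 3) x) (Fin 3)}
    {v : ∀ x : M, TangentSpace (𝓡 3) x} {e f : Fin 3 → ∀ x : M, TangentSpace (𝓡 3) x} {U : Set M}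
    (hU : IsOpen U) (he : ∀ i, SmoothFieldOn (e i) U) (hf : ∀ i, SmoothFieldOn (f i) U)
    (hon : ∀ x ∈ U, Orthonormal ℝ fun i => e i x) (hev : ∀ x ∈ U, e 0 x = ‖v x‖⁻¹ • v x)
    (hpos : ∀ x ∈ U, 0 < (o x).volumeForm fun i => f i x) {p : M} (hp : p ∈ U)
    (hdet : 0 < Matrix.det (Matrix.of fun i j => inner ℝ (e i p) (f j p))) :
    ∃ W : Set M, IsOpen W ∧ p ∈ W ∧ IsAdaptedFrameOn o v e W := by
  let d : M → ℝ := fun x => Matrix.det (Matrix.of fun i j => inner ℝ (e i x) (f j x))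
  have hd : ContinuousOn d U := (continuous_id.matrix_det).comp_continuousOn
    (continuousOn_pi.2 fun i => continuousOn_pi.2 fun j =>
      (smoothOn_inner (he i) (hf j)).continuousOn)
  refine ⟨U ∩ d ⁻¹' Set.Ioi 0, hd.isOpen_inter_preimage hU isOpen_Ioi, ⟨hp, hdet⟩,
    fun i => (he i).mono Set.inter_subset_left, fun x hx => hon x hx.1, fun x hx => hev x hx.1,
    fun x hx => ?_⟩
  have h1 := hpos x hx.1
  rw [volumeForm_eq_mul_det (o x) (hon x hx.1)] at h1
  exact pos_of_mul_pos_left h1 (le_of_lt hx.2)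

theorem exists_isAdaptedFrameOn {o : ∀ x : M, Orientation ℝ (TangentSpace (𝓡 3) x) (Fin 3)}
    (ho : IsOrientation o) {v : ∀ x : M, TangentSpace (𝓡 3) x} (hv : SmoothFieldOn v Set.univ)
    (hv0 : ∀ x, v x ≠ 0) (p : M) :
    ∃ U : Set M, IsOpen U ∧ p ∈ U ∧ ∃ e : Fin 3 → ∀ x : M, TangentSpace (𝓡 3) x,
      IsAdaptedFrameOn o v e U := by
  obtain ⟨U₀, hU₀, hpU₀, f, hf, hpos⟩ := ho p
  let a : ∀ x : M, TangentSpace (𝓡 3) x := fun x => ‖v x‖⁻¹ • v x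
  have ha : SmoothFieldOn a U₀ :=
    smoothFieldOn_normalize (hv.mono (Set.subset_univ _)) fun x _ => hv0 x
  have han : ∀ x, ‖a x‖ = 1 := fun x => by
    rw [norm_smul, norm_inv, norm_norm, inv_mul_cancel₀ (norm_ne_zero_iff.2 (hv0 x))]
  obtain ⟨i, hi⟩ := exists_notMem_span (o p) (hpos p hpU₀).ne' (ι := Fin 1) (by simp) fun _ => a p
  obtain ⟨U₁, hU₁₀, hU₁, hpU₁, b, hb, hbo⟩ := exists_unit_orthogonal (e := fun _ : Fin 1 => a) hU₀
    (fun _ => ha) (fun x _ => ⟨fun _ => han x, fun i j hij => absurd (Subsingleton.elim i j) hij⟩)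
    (hf i) hpU₀ hi
  have hon2 : ∀ x ∈ U₁, Orthonormal ℝ fun k : Fin 2 => ![a, b] k x := by
    intro x hx
    refine ⟨fun k => ?_, fun k l hkl => ?_⟩
    · fin_cases k
      exacts [han x, (hbo x hx).1]
    · fin_cases k <;> fin_cases l
      exacts [absurd rfl hkl, (hbo x hx).2 0, (real_inner_comm _ _).trans ((hbo x hx).2 0),
        absurd rfl hkl]
  obtain ⟨j, hj⟩ := exists_notMem_span (o p) (hpos p hpU₀).ne' (ι := Fin 2) (by simp)
    fun k => ![a, b] k p
  obtain ⟨U₂, hU₂₁, hU₂, hpU₂, c, hc, hco⟩ := exists_unit_orthogonal (e := ![a, b]) hU₁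
    (fun k => by fin_cases k; exacts [ha.mono hU₁₀, hb]) hon2 ((hf j).mono hU₁₀) hpU₁ hj
  have hU₂₀ := hU₂₁.trans hU₁₀
  -- the last vector can be chosen with either sign
  have hframe : ∀ s : ℝ, |s| = 1 →
      (∀ k, SmoothFieldOn ((![a, b, fun x => s • c x] : Fin 3 → ∀ x : M, TangentSpace (𝓡 3) x) k)
        U₂) ∧ ∀ x ∈ U₂, Orthonormal ℝ fun k =>
          (![a, b, fun x => s • c x] : Fin 3 → ∀ x : M, TangentSpace (𝓡 3) x) k x := by
    intro s hs
    refine ⟨fun k => ?_, fun x hx => ?_⟩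
    · fin_cases k
      exacts [ha.mono hU₂₀, hb.mono hU₂₁, ContMDiffOn.const_smul_section hc]
    · have h1 := orthonormal_vec_three (han x) (hbo x (hU₂₁ hx)).1 (c := s • c x)
        (by rw [norm_smul, (hco x hx).1, Real.norm_eq_abs, hs, one_mul])
        ((hbo x (hU₂₁ hx)).2 0)
        (by rw [inner_smul_right]; exact mul_eq_zero_of_right _ ((hco x hx).2 0))
        (by rw [inner_smul_right]; exact mul_eq_zero_of_right _ ((hco x hx).2 1))
      convert h1 using 1
      funext k
      fin_cases k <;> rfl
  let δ : ℝ → ℝ := fun s => Matrix.det (Matrix.of fun k l : Fin 3 =>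
    inner ℝ ((![a, b, fun x => s • c x] : Fin 3 → ∀ x : M, TangentSpace (𝓡 3) x) k p) (f l p))
  have hδs : ∀ s, δ s = s * δ 1 := by
    intro s
    simp only [δ, Matrix.det_fin_three, Matrix.of_apply, Matrix.cons_val_zero, Matrix.cons_val_one,
      Matrix.cons_val, real_inner_smul_left]
    ring
  have hδ0 : δ 1 ≠ 0 := by
    intro h
    have h1 := hpos p hpU₀
    rw [volumeForm_eq_mul_det (o p) ((hframe 1 abs_one).2 p hpU₂)] at h1
    exact h1.ne' (mul_eq_zero_of_right _ h)
  have key : ∀ s : ℝ, |s| = 1 → 0 < δ s → ∃ U : Set M, IsOpen U ∧ p ∈ U ∧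
      ∃ e : Fin 3 → ∀ x : M, TangentSpace (𝓡 3) x, IsAdaptedFrameOn o v e U := by
    intro s hs hδ
    obtain ⟨W, hW, hpW, hadapted⟩ := exists_isAdaptedFrameOn_of_det_pos hU₂ (hframe s hs).1
      (fun k => (hf k).mono hU₂₀) (hframe s hs).2 (v := v) (fun x _ => rfl)
      (fun x hx => hpos x (hU₂₀ hx)) hpU₂ hδ
    exact ⟨W, hW, hpW, _, hadapted⟩
  rcases lt_or_gt_of_ne hδ0 with h | h
  · refine key (-1) (by simp) ?_
    rw [hδs]
    linarith
  · exact key 1 abs_one h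

end AdaptedFrames

end BiHamiltonian

end

theorem theorem1 {M : Type*} [TopologicalSpace M] [ChartedSpace (EuclideanSpace ℝ (Fin 3)) M]
    [IsManifold (𝓡 3) ∞ M]
    [Bundle.RiemannianBundle (fun x : M => TangentSpace (𝓡 3) x)]
    [IsContMDiffRiemannianBundle (𝓡 3) ∞ (EuclideanSpace ℝ (Fin 3))
      (fun x : M => TangentSpace (𝓡 3) x)]
    (o : ∀ x : M, Orientation ℝ (TangentSpace (𝓡 3) x) (Fin 3))
    (ho : BiHamiltonian.IsOrientation o)
    (v : ∀ x : M, TangentSpace (𝓡 3) x)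
    (hv : BiHamiltonian.SmoothFieldOn v Set.univ) (hv0 : ∀ x, v x ≠ 0) :
    -- adapted frames exist around every point
    (∀ p : M, ∃ U : Set M, IsOpen U ∧ p ∈ U ∧ ∃ e : Fin 3 → ∀ x : M, TangentSpace (𝓡 3) x,
      BiHamiltonian.IsAdaptedFrameOn o v e U) ∧
    ∀ (U : Set M) (e : Fin 3 → ∀ x : M, TangentSpace (𝓡 3) x), IsOpen U →
      BiHamiltonian.IsAdaptedFrameOn o v e U →
      -- all solutions of the equations give compatible Poisson structures on their domain,
      -- for which `v` is locally bi-Hamiltonian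
      (∀ (V : Set M) (μ₁ μ₂ α₁ α₂ : M → ℝ), IsOpen V → V ⊆ U →
        BiHamiltonian.IsSolutionOn v e μ₁ μ₂ α₁ α₂ V →
        BiHamiltonian.IsCompatiblePairOn
          (BiHamiltonian.toBivector o (BiHamiltonian.poissonVector e μ₁ α₁))
          (BiHamiltonian.toBivector o (BiHamiltonian.poissonVector e μ₂ α₂)) V ∧
        ∀ p ∈ V, ∃ W ⊆ V, IsOpen W ∧ p ∈ W ∧ ∃ H₁ H₂ : M → ℝ,
          BiHamiltonian.IsBiHamiltonianOn v
            (BiHamiltonian.toBivector o (BiHamiltonian.poissonVector e μ₁ α₁))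
            (BiHamiltonian.toBivector o (BiHamiltonian.poissonVector e μ₂ α₂)) H₁ H₂ W) ∧
      -- around every point there are solutions, with Hamiltonian functions whose gradients are
      -- proportional to the Poisson vector fields
      (∀ p ∈ U, ∃ V ⊆ U, IsOpen V ∧ p ∈ V ∧ ∃ μ₁ μ₂ α₁ α₂ H₁ H₂ : M → ℝ,
        BiHamiltonian.IsSolutionOn v e μ₁ μ₂ α₁ α₂ V ∧
        BiHamiltonian.IsCompatiblePairOn
          (BiHamiltonian.toBivector o (BiHamiltonian.poissonVector e μ₁ α₁))
          (BiHamiltonian.toBivector o (BiHamiltonian.poissonVector e μ₂ α₂)) V ∧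
        BiHamiltonian.IsBiHamiltonianOn v
          (BiHamiltonian.toBivector o (BiHamiltonian.poissonVector e μ₁ α₁))
          (BiHamiltonian.toBivector o (BiHamiltonian.poissonVector e μ₂ α₂)) H₁ H₂ V ∧
        ∀ x ∈ V,
          BiHamiltonian.poissonVector e μ₁ α₁ x =
            -BiHamiltonian.phi v μ₁ μ₂ α₁ α₂ x • BiHamiltonian.grad H₁ x ∧
          BiHamiltonian.poissonVector e μ₂ α₂ x =
            BiHamiltonian.phi v μ₁ μ₂ α₁ α₂ x • BiHamiltonian.grad H₂ x) := by
  have hN : BiHamiltonian.SmoothOn (fun x => ‖v x‖) Set.univ :=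
    BiHamiltonian.smoothOn_norm hv fun x _ => hv0 x
  refine ⟨BiHamiltonian.exists_isAdaptedFrameOn ho hv hv0, fun U e hU he => ⟨?_, ?_⟩⟩
  · intro V μ₁ μ₂ α₁ α₂ hV hVU h
    have hNV := hN.mono (Set.subset_univ V)
    have hcomp := he.isCompatiblePairOn hv0 hNV hV hVU h
    refine ⟨hcomp, fun p hp => ?_⟩
    obtain ⟨W₁, hW₁V, hW₁, hpW₁, H₂, hH₂⟩ := he.exists_isHamiltonianOn hv0 hNV hV hVU h.smooth_μ₁
      h.smooth_α₁ h.α₁_ne h.riccati₁ h.transport₁ hp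
    obtain ⟨W₂, hW₂V, hW₂, hpW₂, H₁, hH₁⟩ := he.exists_isHamiltonianOn hv0 hNV hV hVU h.smooth_μ₂
      h.smooth_α₂ h.α₂_ne h.riccati₂ h.transport₂ hp
    have hWV : W₁ ∩ W₂ ⊆ V := fun x hx => hW₁V hx.1
    refine ⟨W₁ ∩ W₂, hWV, hW₁.inter hW₂, ⟨hpW₁, hpW₂⟩, H₁, H₂, ?_⟩
    exact
      { poisson₁ := hcomp.poisson₁.mono hWV
        poisson₂ := hcomp.poisson₂.mono hWV
        independent := fun x hx => hcomp.independent x (hWV hx)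
        hamiltonian₁ := hH₂.mono Set.inter_subset_left
        hamiltonian₂ := hH₁.mono Set.inter_subset_right }
  · intro p hp
    exact he.exists_solution hv0 (hN.mono (Set.subset_univ U)) hU hp
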